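/- **Setting.** Let $\Omega\subset\mathbb R^\nu$ be open, $\lambda>0$, $g:\Omega\times[0,1]\to\mathbb R^\nu$, $f:\Omega\times[0,1]\to\mathbb R$, and let $L_g,M_g,L_f,M_f>0$ be such that for all $x,\bar x\in\Omega$, $a,\bar a\in[0,1]$ $$\|g(x,a)-g(\bar x,\bar a)\|\le L_g(\|x-\bar x\|+|a-\bar a|),\quad \|g(x,a)\|\le M_g,$$ $$|f(x,a)-f(\bar x,\bar a)|\le L_f(\|x-\bar x\|+|a-\bar a|),\quad |f(x,a)|\le M_f,$$ with Euclidean norms. For $a\in[0,1]$ let $\mathcal A(a)$ be the set of non-decreasing $\alpha:[0,\infty)\to[0,1]$ with $\alpha(0)\ge a$. Assume that for every $x\in\Omega$ and $\alpha\in\mathcal A(0)$ there is a continuous $y:[0,\infty)\to\Omega$ with $y(t)=x+\int_0^t g(y(s),\alpha(s))\,ds$ for all $t\ge 0$ (it is then unique). The value function is $$u(x,a)=\inf_{\alpha\in\mathcal A(a)}\int_0^\infty f(y(s),\alpha(s))e^{-\lambda s}\,ds .$$ Let $\gamma=1$ if $\lambda>L_g$, $\gamma=\lambda/L_g$ if $\lambda<L_g$,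 and let $\gamma\in(0,1)$ be arbitrary if $\lambda=L_g$. **Discretization.** Let $0<h<1/\lambda$ with $1/h$ an integer, $I_h=\{ih: i=0,\dots,1/h\}$ and $I_h(a)=I_h\cap[a,1]$. Let $\Omega_k\subset\Omega$ be the union of a finite triangulation by nondegenerate $\nu$-simplices whose largest diameter is $k>0$, such that $x+hg(x,a)\in\Omega_k$ for all $x\in\Omega_k$, $a\in I_h$. Let $W_k$ be the set of functions $w:\Omega_k\times I_h\to\mathbb R$ such that for each $a\in I_h$ the function $w(\cdot,a)$ is continuous on $\Omega_k$ and affine on each simplex, and let $A_k^h:W_k\to W_k$ be defined by its values at the vertices $x^i$ of the triangulation: $$(A_k^hw)(x^i,a)=\min_{b\in I_h(a)}\{(1-\lambda h)\,w(x^i+hg(x^i,a),b)+hf(x^i,a)\},\qquad a\in I_h.$$ **Statement.** The operator $A_k^h$ has a unique fixed point $u_k^h\in W_k$, and, without any semiconcavity assumption, the following holds. 1. There is a constant $M>0$, independent of $h$, $k$ and the triangulation, such that for all such discretizations and all $x\in\Omega_k$, $a\in I_h$, $$|u(x,a)-u_k^h(x,a)|\le M\Big(h+\frac{k}{\sqrt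 h}\Big)^\gamma .$$ 2. For all $c_1,c_2>0$ there is a constant $C>0$, independent of $h$, $k$ and the triangulation, such that for all discretizations with $c_1k^{2/3}\le h\le c_2k^{2/3}$ and all $x\in\Omega_k$, $a\in I_h$, $$|u(x,a)-u_k^h(x,a)|\le C\,k^{\frac23\gamma}.$$ 3. This is the best rate that can be obtained from the estimate in 1: for all $h,k>0$ one has $(h+k/\sqrt h)^\gamma\ge k^{\frac23\gamma}$, while for all $c_1,c_2>0$ there is $C>0$ such that $(h+k/\sqrt h)^\gamma\le C\,k^{\frac23\gamma}$ for all $h,k>0$ with $c_1k^{2/3}\le h\le c_2k^{2/3}$. 4. For all $c_1,c_2>0$ there is a constant $C>0$, independent of $h$, $k$ and the triangulation, such that for all discretizations with $c_1k\le h\le c_2k$ and all $x\in\Omega_k$, $a\in I_h$, $$|u(x,a)-u_k^h(x,a)|\le C\,k^{\gamma/2}.$$ -/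

import Mathlib

open MeasureTheory Set

noncomputable section

namespace MonotoneControl

/-- The Euclidean space `ℝ^ν`. -/
abbrev E (ν : ℕ) := EuclideanSpace ℝ (Fin ν)

/-! ### The infinite horizon problem with monotone controls -/

/-- `α ∈ 𝒜(a)`: a non-decreasing function on `[0,∞)` with values in `[0,1]` and `α(0) ≥ a`.
Values of `α` at negative times are irrelevant. -/
structure IsControl (a : ℝ) (α : ℝ → ℝ) : Prop where
  monotoneOn : MonotoneOn α (Ici 0)
  mem_Icc : ∀ s, 0 ≤ s → α s ∈ Icc (0 : ℝ) 1
  le_initial : a ≤ α 0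

/-- `y : [0,∞) → Ω` is the (Carathéodory) solution of `y' = g(y, α)`, `y(0) = x`.
The control may have jumps, so the equation is meant in integrated form. -/
structure IsTrajectory {ν : ℕ} (Ω : Set (E ν)) (g : E ν → ℝ → E ν) (x : E ν) (α : ℝ → ℝ)
    (y : ℝ → E ν) : Prop where
  continuousOn : ContinuousOn y (Ici 0)
  mem : ∀ t, 0 ≤ t → y t ∈ Ω
  eq_integral : ∀ t, 0 ≤ t → y t = x + ∫ s in (0 : ℝ)..t, g (y s) (α s)

/-- The discounted cost `∫₀^∞ f(y(s), α(s)) e^{-λ s} ds`. -/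
def cost {ν : ℕ} (f : E ν → ℝ → ℝ) (lam : ℝ) (α : ℝ → ℝ) (y : ℝ → E ν) : ℝ :=
  ∫ s in Ioi (0 : ℝ), f (y s) (α s) * Real.exp (-lam * s)

/-- The value function `u(x,a) = inf_{α ∈ 𝒜(a)} J(x, α)`. -/
def value {ν : ℕ} (Ω : Set (E ν)) (g : E ν → ℝ → E ν) (f : E ν → ℝ → ℝ) (lam : ℝ)
    (x : E ν) (a : ℝ) : ℝ :=
  sInf {c : ℝ | ∃ (α : ℝ → ℝ) (y : ℝ → E ν),
    IsControl a α ∧ IsTrajectory Ω g x α y ∧ c = cost f lam α y}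

/-- `γ` is the Hölder exponent of the value function: `γ = 1` if `λ > L_g`, `γ = λ / L_g` if
`λ < L_g`, and `γ` is an arbitrary number of `(0,1)` if `λ = L_g`. -/
structure IsHolderExponent (lam Lg γ : ℝ) : Prop where
  of_gt : Lg < lam → γ = 1
  of_lt : lam < Lg → γ = lam / Lg
  of_eq : lam = Lg → γ ∈ Ioo (0 : ℝ) 1

/-! ### The fully discrete problem -/

/-- The control grid `I_h = {i h | i = 0, …, 1/h}`. -/
def controlGrid (h : ℝ) : Set ℝ :=
  {b : ℝ | ∃ i : ℕ, (i : ℝ) ≤ 1 / h ∧ b = i * h}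

/-- `I_h(a) = I_h ∩ [a,1]`. -/
def controlGridFrom (h a : ℝ) : Set ℝ :=
  controlGrid h ∩ Icc a 1

/-- `(A^{h,b} w)(x,a) = (1 - λ h) w(x + h g(x,a), b) + h f(x,a)`. -/
def timeStep {ν : ℕ} (g : E ν → ℝ → E ν) (f : E ν → ℝ → ℝ) (lam h b : ℝ)
    (w : E ν → ℝ → ℝ) (x : E ν) (a : ℝ) : ℝ :=
  (1 - lam * h) * w (x + h • g x a) b + h * f x a

/-- `K` is a finite triangulation by nondegenerate `ν`-simplices (the faces of `K` with `ν + 1`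
vertices; the other faces of `K` are faces of these), of mesh `k`, whose polyhedron
`Ω_k = K.space` is contained in `Ω`. -/
structure IsTriangulation {ν : ℕ} (Ω : Set (E ν)) (K : Geometry.SimplicialComplex ℝ (E ν))
    (k : ℝ) : Prop where
  finite : K.faces.Finite
  pure : ∀ s ∈ K.faces, ∃ t ∈ K.faces, s ⊆ t ∧ t.card = ν + 1
  mesh : IsGreatest {d : ℝ | ∃ s ∈ K.faces, s.card = ν + 1 ∧
    d = Metric.diam (convexHull ℝ (s : Set (E ν)))} k
  space_subset : K.space ⊆ Ω

/-- Admissible discretizations: a triangulation of mesh `k > 0` and a step `h > 0` with `1 / h` an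
integer and `λ h < 1`, such that the polyhedron `Ω_k` is stable under the discrete dynamics
`x ↦ x + h g(x,a)`, `a ∈ I_h`. -/
structure IsDiscretization {ν : ℕ} (Ω : Set (E ν)) (g : E ν → ℝ → E ν) (lam : ℝ)
    (K : Geometry.SimplicialComplex ℝ (E ν)) (k h : ℝ) : Prop where
  triangulation : IsTriangulation Ω K k
  mesh_pos : 0 < k
  step_pos : 0 < h
  step_inv : ∃ m : ℕ, 1 / h = m
  step_small : lam * h < 1
  stable : ∀ x ∈ K.space, ∀ a ∈ controlGrid h, x + h • g x a ∈ K.space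

/-- `w ∈ W_k`: for every `a ∈ I_h` the function `w(·,a)` is continuous on `Ω_k` and affine on every
simplex. Only the values of `w` on `Ω_k × I_h` are relevant. -/
structure IsFiniteElement {ν : ℕ} (K : Geometry.SimplicialComplex ℝ (E ν)) (h : ℝ)
    (w : E ν → ℝ → ℝ) : Prop where
  continuousOn : ∀ a ∈ controlGrid h, ContinuousOn (fun x => w x a) K.space
  affine : ∀ a ∈ controlGrid h, ∀ s ∈ K.faces, ∃ A : E ν →ᵃ[ℝ] ℝ,
    ∀ x ∈ convexHull ℝ (s : Set (E ν)), w x a = A x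

/-- `v = A_k^h w`: `v` is the element of `W_k` with the nodal values
`v(xⁱ,a) = min_{b ∈ I_h(a)} {(1 - λ h) w(xⁱ + h g(xⁱ,a), b) + h f(xⁱ,a)}`. -/
structure IsBellmanImage {ν : ℕ} (g : E ν → ℝ → E ν) (f : E ν → ℝ → ℝ) (lam : ℝ)
    (K : Geometry.SimplicialComplex ℝ (E ν)) (h : ℝ) (v w : E ν → ℝ → ℝ) : Prop where
  finiteElement : IsFiniteElement K h v
  nodal : ∀ x ∈ K.vertices, ∀ a ∈ controlGrid h,
    IsLeast ((fun b => timeStep g f lam h b w x a) '' controlGridFrom h a) (v x a)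

/-- `w = u_k^h` is the fully discrete solution: an element of `W_k` with `w = A_k^h w`. -/
def IsFullyDiscreteSolution {ν : ℕ} (g : E ν → ℝ → E ν) (f : E ν → ℝ → ℝ) (lam : ℝ)
    (K : Geometry.SimplicialComplex ℝ (E ν)) (h : ℝ) (w : E ν → ℝ → ℝ) : Prop :=
  IsFiniteElement K h w ∧ IsBellmanImage g f lam K h w w

end MonotoneControl

end

open MeasureTheory Set

noncomputable section

namespace MonotoneControl

/-! Evaluating a finite element at `x` means averaging its nodal values with the barycentric
coordinates of `x`. Read these coordinates as probabilities: the scheme is then the dynamic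
programming equation of a random system which jumps from `x` to a vertex of its simplex and then
makes an Euler step. The jump has mean zero and length at most `k`, so it adds at most `k ^ 2` to
the mean square distance to any given point (`sum_mul_sq_norm_sub_le`). Over a time of order one
there are about `1 / h` jumps. Their errors add up in quadrature, to `k / √h`, whereas adding
lengths would give `k / h`.

This system is compared with the controlled differential equation. The difference of running costs,
`min (2 * Mf) (Lf * d)`, is a concave function of the squared distance, and the deterministic step
preserves concavity, so Jensen's inequality lets the mean square distance alone be followed
(`le_majorant`). Consistency errors are `h * (h + δ n)`, where `δ n` is the increment of the sampled
control. A monotone control has total increment at most one, so they sum to order `h` although the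
control may jump. Discounting a distance that grows like `X * (1 + Lg * h) ^ n`, truncated by the
bound on `f`, gives order `X ^ γ` with `X` of order `h + k / √h` (`exists_discounted_sum_le`,
`exists_comparison_bound`).

The two one-sided estimates apply this bound in opposite directions: a continuous control imitates
the discrete minimizers (`exists_value_sub_le`), and the scheme imitates a sampled continuous
control (`exists_sub_value_le`). Only Lipschitz bounds enter. -/

/-! ### The Hölder exponent and discounted sums. -/

theorem IsHolderExponent.pos {lam Lg γ : ℝ} (hγ : IsHolderExponent lam Lg γ) (hlam : 0 < lam)
    (hLg : 0 < Lg) : 0 < γ := by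
  rcases lt_trichotomy lam Lg with h | h | h
  · rw [hγ.of_lt h]; positivity
  · exact (hγ.of_eq h).1
  · rw [hγ.of_gt h]; exact one_pos

theorem IsHolderExponent.le_one {lam Lg γ : ℝ} (hγ : IsHolderExponent lam Lg γ)
    (hLg : 0 < Lg) : γ ≤ 1 := by
  rcases lt_trichotomy lam Lg with h | h | h
  · rw [hγ.of_lt h, div_le_one hLg]; exact h.le
  · exact (hγ.of_eq h).2.le
  · exact (hγ.of_gt h).le

theorem sum_geometric_le {r : ℝ} (h0 : 0 ≤ r) (h1 : r < 1) (N : ℕ) :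
    ∑ n ∈ Finset.range N, r ^ n ≤ 1 / (1 - r) := by
  have h2 : 0 < 1 - r := by linarith
  rw [geom_sum_eq h1.ne, le_div_iff₀ h2]
  have : (r ^ N - 1) / (r - 1) * (1 - r) = 1 - r ^ N := by
    have : r - 1 ≠ 0 := by linarith
    field_simp
    ring
  rw [this]
  linarith [pow_nonneg h0 N]

theorem min_le_rpow_mul_rpow {G Y γ : ℝ} (hG : 0 < G) (hY : 0 < Y) (h0 : 0 ≤ γ) (h1 : γ ≤ 1) :
    min G Y ≤ G ^ (1 - γ) * Y ^ γ := by
  have hm : 0 < min G Y := lt_min hG hY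
  calc min G Y = (min G Y) ^ (1 - γ) * (min G Y) ^ γ := by
        rw [← Real.rpow_add hm]; simp
    _ ≤ G ^ (1 - γ) * Y ^ γ := by
        have h2 : 0 ≤ 1 - γ := by linarith
        exact mul_le_mul (Real.rpow_le_rpow hm.le (min_le_left _ _) h2)
          (Real.rpow_le_rpow hm.le (min_le_right _ _) h0) (by positivity) (by positivity)

/-- Bernoulli's inequality for an exponent at most one; the term of order `h ^ 2` has a favourable
sign. Discounting thus beats the growth of the `γ`-th power of a distance when `γ * Lg < lam`, and
balances it when `γ * Lg = lam`. -/
theorem one_sub_mul_rpow_le {lam Lg γ h : ℝ} (hLg : 0 < Lg) (hh : 0 < h) (hlh : lam * h < 1)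
    (h0 : 0 ≤ γ) (h1 : γ ≤ 1) (hlam : 0 < lam) :
    (1 - lam * h) * (1 + Lg * h) ^ γ ≤ 1 - (lam - γ * Lg) * h := by
  have hs : 0 ≤ Lg * h := by positivity
  have h2 : (1 + Lg * h) ^ γ ≤ 1 + γ * (Lg * h) :=
    rpow_one_add_le_one_add_mul_self (by linarith) h0 h1
  have h3 : (1 - lam * h) * (1 + Lg * h) ^ γ ≤ (1 - lam * h) * (1 + γ * (Lg * h)) := by
    apply mul_le_mul_of_nonneg_left h2; linarith
  have h4 : 0 ≤ lam * h * (γ * (Lg * h)) := by positivity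
  nlinarith

/-- Replacing the minimum by the geometric mean `G ^ (1 - γ) * Y ^ γ` leaves a geometric series of
ratio at most `1 - (lam - γ * Lg) * h`, whose sum of order `1 / h` is cancelled by the factor `h`.
-/
theorem discounted_sum_le_of_lt {lam Lg γ G h X : ℝ} (hLg : 0 < Lg) (h0 : 0 ≤ γ)
    (h1 : γ ≤ 1) (hlam : 0 < lam) (hG : 0 < G) (hlt : γ * Lg < lam) (hh : 0 < h)
    (hlh : lam * h < 1) (hX : 0 < X) (N : ℕ) :
    ∑ n ∈ Finset.range N, h * (1 - lam * h) ^ n * min G (X * (1 + Lg * h) ^ n) ≤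
      G ^ (1 - γ) / (lam - γ * Lg) * X ^ γ := by
  have hp : 0 < 1 - lam * h := by linarith
  have hq : 0 < 1 + Lg * h := by positivity
  have hd : 0 < lam - γ * Lg := by linarith
  set r := 1 - (lam - γ * Lg) * h with hr
  have hr0 := one_sub_mul_rpow_le hLg hh hlh h0 h1 hlam
  have hpq : 0 < (1 - lam * h) * (1 + Lg * h) ^ γ := by positivity
  have hr1 : r < 1 := by have := mul_pos hd hh; rw [hr]; linarith
  calc ∑ n ∈ Finset.range N, h * (1 - lam * h) ^ n * min G (X * (1 + Lg * h) ^ n)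
      ≤ ∑ n ∈ Finset.range N, h * G ^ (1 - γ) * X ^ γ * r ^ n := by
        refine Finset.sum_le_sum fun n _ => ?_
        have hY : 0 < X * (1 + Lg * h) ^ n := by positivity
        calc h * (1 - lam * h) ^ n * min G (X * (1 + Lg * h) ^ n)
            ≤ h * (1 - lam * h) ^ n * (G ^ (1 - γ) * (X * (1 + Lg * h) ^ n) ^ γ) := by
              gcongr
              exact min_le_rpow_mul_rpow hG hY h0 h1
          _ = h * G ^ (1 - γ) * X ^ γ * ((1 - lam * h) * (1 + Lg * h) ^ γ) ^ n := by
              rw [Real.mul_rpow hX.le (by positivity), ← Real.rpow_natCast (1 + Lg * h) n,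
                ← Real.rpow_mul hq.le, mul_pow, ← Real.rpow_natCast ((1 + Lg * h) ^ γ) n,
                ← Real.rpow_mul hq.le, mul_comm γ]
              ring
          _ ≤ _ := by gcongr
    _ = h * G ^ (1 - γ) * X ^ γ * ∑ n ∈ Finset.range N, r ^ n := by rw [Finset.mul_sum]
    _ ≤ h * G ^ (1 - γ) * X ^ γ * (1 / (1 - r)) := by
        gcongr
        exact sum_geometric_le (hpq.le.trans hr0) hr1 N
    _ = G ^ (1 - γ) / (lam - γ * Lg) * X ^ γ := by
        have : 1 - r = (lam - γ * Lg) * h := by rw [hr]; ring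
        rw [this]; field_simp

/-- At equality the geometric mean no longer gives a bound uniform in `N`. The sum is split at the
first index `N0` where the growing quantity reaches `G`: before it the terms grow geometrically and
the last ones dominate, after it only the discount matters and `p ^ N0 ≤ (X / G) ^ γ`. -/
theorem discounted_sum_le_of_eq {lam Lg γ G h X : ℝ} (hLg : 0 < Lg) (h0 : 0 < γ)
    (h1 : γ < 1) (hlam : 0 < lam) (hG : 0 < G) (heq : γ * Lg = lam) (hh : 0 < h) (hh1 : h ≤ 1)
    (hlh : lam * h < 1) (hX : 0 < X) (N : ℕ) :
    ∑ n ∈ Finset.range N, h * (1 - lam * h) ^ n * min G (X * (1 + Lg * h) ^ n) ≤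
      (((1 + Lg) * G) ^ (1 - γ) * ((1 + Lg) / ((1 - γ) * Lg)) + G / lam / G ^ γ) * X ^ γ := by
  have hp : 0 < 1 - lam * h := by linarith
  have hp1 : 1 - lam * h < 1 := by have := mul_pos hlam hh; linarith
  have hq1 : 1 < 1 + Lg * h := by have := mul_pos hLg hh; linarith
  have hγ1 : 0 < 1 - γ := by linarith
  set p := 1 - lam * h with hpdef
  set q := 1 + Lg * h with hqdef
  have hq : 0 < q := by linarith
  have hqL : q ≤ 1 + Lg := by rw [hqdef]; nlinarith
  have hpq : p * q ^ γ ≤ 1 := by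
    have := one_sub_mul_rpow_le hLg hh hlh h0.le h1.le hlam
    rwa [heq, sub_self, zero_mul, sub_zero] at this
  have hqγ : 0 < q ^ γ := Real.rpow_pos_of_pos hq _
  have hpow : ∀ n : ℕ, p ^ n * (q ^ n) ^ γ ≤ 1 := by
    intro n
    have : (q ^ n) ^ γ = (q ^ γ) ^ n := by
      rw [← Real.rpow_natCast q n, ← Real.rpow_mul hq.le, ← Real.rpow_natCast (q ^ γ) n,
        ← Real.rpow_mul hq.le, mul_comm]
    rw [this, ← mul_pow]
    exact pow_le_one₀ (by positivity) hpq
  have hex : ∃ n : ℕ, G ≤ X * q ^ n := by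
    obtain ⟨n, hn⟩ := pow_unbounded_of_one_lt (G / X) hq1
    exact ⟨n, by rw [div_lt_iff₀ hX] at hn; linarith⟩
  classical
  obtain ⟨N0, hN0, hmin⟩ : ∃ n : ℕ, G ≤ X * q ^ n ∧ ∀ m < n, X * q ^ m < G :=
    ⟨Nat.find hex, Nat.find_spec hex, fun m hm => not_le.1 (Nat.find_min hex hm)⟩
  set R := q ^ (1 - γ) with hR
  -- The ratio exceeds one by an amount of order `h`, through `exp t ≥ 1 + t` and `log q ≥ 1 - q⁻¹`;
  -- this makes `h / (R - 1)` bounded.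
  have hR1 : (1 - γ) * Lg * h / (1 + Lg) ≤ R - 1 := by
    have e1 : R = Real.exp ((1 - γ) * Real.log q) := by
      rw [hR, Real.rpow_def_of_pos hq, mul_comm]
    have e2 : 1 - q⁻¹ ≤ Real.log q := Real.one_sub_inv_le_log_of_pos hq
    have e3 := Real.add_one_le_exp ((1 - γ) * Real.log q)
    have e4 : Lg * h / (1 + Lg) ≤ 1 - q⁻¹ := by
      have : 1 - q⁻¹ = Lg * h / q := by rw [hqdef]; field_simp; ring
      rw [this]; gcongr
    have e5 : (1 - γ) * (Lg * h / (1 + Lg)) ≤ (1 - γ) * Real.log q :=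
      mul_le_mul_of_nonneg_left (e4.trans e2) hγ1.le
    rw [e1]
    calc (1 - γ) * Lg * h / (1 + Lg) = (1 - γ) * (Lg * h / (1 + Lg)) := by ring
      _ ≤ _ := by linarith
  have hRpos : 0 < R - 1 := lt_of_lt_of_le (by positivity) hR1
  have hterm : ∀ n, 0 ≤ h * p ^ n * min G (X * q ^ n) := fun n => by positivity
  have hA : ∑ n ∈ Finset.range N0, h * p ^ n * min G (X * q ^ n) ≤
      ((1 + Lg) * G) ^ (1 - γ) * ((1 + Lg) / ((1 - γ) * Lg)) * X ^ γ := by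
    rcases Nat.eq_zero_or_pos N0 with rfl | hpos
    · simp only [Finset.range_zero, Finset.sum_empty]; positivity
    -- One step earlier the quantity was still below `G`, so it overshoots by at most a factor `q`.
    have hXq : X * q ^ N0 ≤ (1 + Lg) * G := by
      have h2 := hmin (N0 - 1) (by omega)
      have h3 : q ^ N0 = q * q ^ (N0 - 1) := by rw [← pow_succ']; congr 1; omega
      rw [h3]
      calc X * (q * q ^ (N0 - 1)) = q * (X * q ^ (N0 - 1)) := by ring
        _ ≤ (1 + Lg) * G := by gcongr
    calc ∑ n ∈ Finset.range N0, h * p ^ n * min G (X * q ^ n)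
        ≤ ∑ n ∈ Finset.range N0, h * X * R ^ n := by
          refine Finset.sum_le_sum fun n _ => ?_
          have h4 : R ^ n * (q ^ n) ^ γ = q ^ n := by
            rw [hR, ← Real.rpow_natCast (q ^ (1 - γ)) n, ← Real.rpow_mul hq.le,
              ← Real.rpow_natCast q n, ← Real.rpow_mul hq.le, ← Real.rpow_add hq]
            congr 1; ring
          calc h * p ^ n * min G (X * q ^ n) ≤ h * p ^ n * (X * q ^ n) := by
                gcongr; exact min_le_right _ _
            _ = h * p ^ n * (X * (R ^ n * (q ^ n) ^ γ)) := by rw [h4]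
            _ = h * X * R ^ n * (p ^ n * (q ^ n) ^ γ) := by ring
            _ ≤ h * X * R ^ n * 1 := by gcongr; exact hpow n
            _ = _ := mul_one _
      _ = h * X * ((R ^ N0 - 1) / (R - 1)) := by
          rw [← Finset.mul_sum, geom_sum_eq (by linarith)]
      _ ≤ h * X * (R ^ N0 / ((1 - γ) * Lg * h / (1 + Lg))) := by
          gcongr
          linarith
      _ = X * R ^ N0 * ((1 + Lg) / ((1 - γ) * Lg)) := by field_simp
      _ = (X * q ^ N0) ^ (1 - γ) * ((1 + Lg) / ((1 - γ) * Lg)) * X ^ γ := by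
          have : R ^ N0 = (q ^ N0) ^ (1 - γ) := by
            rw [hR, ← Real.rpow_natCast (q ^ (1 - γ)) N0, ← Real.rpow_mul hq.le,
              ← Real.rpow_natCast q N0, ← Real.rpow_mul hq.le, mul_comm]
          rw [this, Real.mul_rpow hX.le (by positivity)]
          have h5 : X = X ^ (1 - γ) * X ^ γ := by rw [← Real.rpow_add hX]; simp
          conv_lhs => rw [h5]
          ring
      _ ≤ _ := by gcongr
  have hB : ∑ n ∈ Finset.range N, h * p ^ (N0 + n) * min G (X * q ^ (N0 + n)) ≤
      G / lam / G ^ γ * X ^ γ := by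
    have hpN : p ^ N0 ≤ X ^ γ / G ^ γ := by
      rw [le_div_iff₀ (by positivity)]
      calc p ^ N0 * G ^ γ ≤ p ^ N0 * (X * q ^ N0) ^ γ := by gcongr
        _ = (p ^ N0 * (q ^ N0) ^ γ) * X ^ γ := by
            rw [Real.mul_rpow hX.le (by positivity)]; ring
        _ ≤ 1 * X ^ γ := by gcongr; exact hpow N0
        _ = _ := one_mul _
    calc ∑ n ∈ Finset.range N, h * p ^ (N0 + n) * min G (X * q ^ (N0 + n))
        ≤ ∑ n ∈ Finset.range N, h * p ^ N0 * G * p ^ n := by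
          refine Finset.sum_le_sum fun n _ => ?_
          calc h * p ^ (N0 + n) * min G (X * q ^ (N0 + n)) ≤ h * p ^ (N0 + n) * G := by
                gcongr; exact min_le_left _ _
            _ = _ := by rw [pow_add]; ring
      _ = h * p ^ N0 * G * ∑ n ∈ Finset.range N, p ^ n := by rw [Finset.mul_sum]
      _ ≤ h * p ^ N0 * G * (1 / (1 - p)) := by gcongr; exact sum_geometric_le hp.le hp1 N
      _ = p ^ N0 * (G / lam) := by
          have : 1 - p = lam * h := by rw [hpdef]; ring
          rw [this]; field_simp
      _ ≤ X ^ γ / G ^ γ * (G / lam) := by gcongr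
      _ = _ := by ring
  calc ∑ n ∈ Finset.range N, h * p ^ n * min G (X * q ^ n)
      ≤ ∑ n ∈ Finset.range (N0 + N), h * p ^ n * min G (X * q ^ n) :=
        Finset.sum_le_sum_of_subset_of_nonneg
          (Finset.range_mono (by omega)) fun n _ _ => hterm n
    _ = _ := Finset.sum_range_add _ _ _
    _ ≤ _ := by rw [add_mul]; exact add_le_add hA hB

/-- Discounted sums of an exponentially growing quantity truncated at `G` are Hölder continuous,
with exponent `γ`, in the initial size of this quantity. -/
theorem exists_discounted_sum_le {lam Lg γ G : ℝ} (hγ : IsHolderExponent lam Lg γ)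
    (hlam : 0 < lam) (hLg : 0 < Lg) (hG : 0 < G) :
    ∃ C : ℝ, 0 < C ∧ ∀ h X : ℝ, 0 < h → h ≤ 1 → lam * h < 1 → 0 < X → ∀ N : ℕ,
      ∑ n ∈ Finset.range N, h * (1 - lam * h) ^ n * min G (X * (1 + Lg * h) ^ n) ≤
        C * X ^ γ := by
  have h0 := hγ.pos hlam hLg
  have h1 := hγ.le_one hLg
  rcases lt_or_ge (γ * Lg) lam with hlt | hge
  · refine ⟨G ^ (1 - γ) / (lam - γ * Lg), ?_, fun h X hh _ hlh hX N =>
      discounted_sum_le_of_lt hLg h0.le h1 hlam hG hlt hh hlh hX N⟩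
    have : 0 < lam - γ * Lg := by linarith
    positivity
  -- If `lam = Lg`, the choice `γ < 1` restores the strict inequality; if `lam > Lg`, it holds with
  -- `γ = 1`. Equality is met only for `lam < Lg`.
  · have hcase : lam < Lg := by
      rcases lt_trichotomy lam Lg with h | h | h
      · exact h
      · have := (hγ.of_eq h).2; nlinarith
      · rw [hγ.of_gt h] at hge; linarith
    have hγeq := hγ.of_lt hcase
    have hγ1 : γ < 1 := by rw [hγeq, div_lt_one hLg]; exact hcase
    have heq : γ * Lg = lam := by rw [hγeq]; field_simp
    refine ⟨_, ?_, fun h X hh hh1 hlh hX N =>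
      discounted_sum_le_of_eq hLg h0 hγ1 hlam hG heq hh hh1 hlh hX N⟩
    have : 0 < 1 - γ := by linarith
    positivity

/-! ### Jensen's inequality and the majorant. -/

/-- Majorant over `N` steps, starting at time `n`, of the difference of the values of two controlled
systems whose mean square distance is `R` just after the random perturbation. One step turns the
distance `d` into `q d + Δ n`, a perturbation adds at most `k ^ 2` to its mean square. -/
def majorant (p q k : ℝ) (F : ℝ → ℝ) (Δ e : ℕ → ℝ) (C : ℝ) : ℕ → ℕ → ℝ → ℝ
  | 0, _, _ => C
  | N + 1, n, R => p * majorant p q k F Δ e C N (n + 1) ((q * √R + Δ n) ^ 2 + k ^ 2) + (F R + e n)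

section majorant

variable {p q k C : ℝ} {F : ℝ → ℝ} {Δ e : ℕ → ℝ}

/-- Expanding the square leaves an affine function of `R` plus `2 * q * c * √R`, which is concave
because `q` and `c` are nonnegative. -/
theorem concaveOn_sq_mul_sqrt_add (hq : 0 ≤ q) {c : ℝ} (hc : 0 ≤ c) (k : ℝ) :
    ConcaveOn ℝ (Ici 0) fun R => (q * √R + c) ^ 2 + k ^ 2 := by
  have h1 : ConcaveOn ℝ (Ici (0 : ℝ)) fun R => (2 * q * c) • √R :=
    Real.strictConcaveOn_sqrt.concaveOn.smul (by positivity)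
  have h2 : ConcaveOn ℝ (Ici (0 : ℝ)) fun R : ℝ => (q ^ 2) • R :=
    (concaveOn_id (convex_Ici 0)).smul (by positivity)
  refine ((h1.add h2).add_const (c ^ 2 + k ^ 2)).congr fun R hR => ?_
  have := Real.sq_sqrt (show 0 ≤ R from hR)
  simp only [Pi.add_apply, smul_eq_mul]
  linear_combination (-q ^ 2) * this

theorem majorant_monotoneOn (hp : 0 ≤ p) (hq : 0 ≤ q) (hΔ : ∀ n, 0 ≤ Δ n)
    (hF : MonotoneOn F (Ici 0)) (N : ℕ) :
    ∀ n, MonotoneOn (majorant p q k F Δ e C N n) (Ici 0) := by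
  induction N with
  | zero => intro n R _ R' _ _; exact le_rfl
  | succ N ih =>
    intro n R hR R' hR' hRR
    have h1 : (q * √R + Δ n) ^ 2 + k ^ 2 ≤ (q * √R' + Δ n) ^ 2 + k ^ 2 := by
      have := hΔ n
      gcongr
    have h2 := ih (n + 1) (show _ ∈ Ici (0 : ℝ) from by simp only [mem_Ici]; positivity)
      (show _ ∈ Ici (0 : ℝ) from by simp only [mem_Ici]; positivity) h1
    simp only [majorant]
    gcongr
    exact hF hR hR' hRR

/-- A concave nondecreasing function composed with a concave one is concave, hence the need for
`majorant_monotoneOn`. -/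
theorem majorant_concaveOn (hp : 0 ≤ p) (hq : 0 ≤ q) (hΔ : ∀ n, 0 ≤ Δ n)
    (hF : MonotoneOn F (Ici 0)) (hFc : ConcaveOn ℝ (Ici 0) F) (N : ℕ) :
    ∀ n, ConcaveOn ℝ (Ici 0) (majorant p q k F Δ e C N n) := by
  induction N with
  | zero => intro n; exact concaveOn_const C (convex_Ici 0)
  | succ N ih =>
    intro n
    set φ : ℝ → ℝ := fun R => (q * √R + Δ n) ^ 2 + k ^ 2 with hφ
    have hφc : ConcaveOn ℝ (Ici 0) φ := concaveOn_sq_mul_sqrt_add hq (hΔ n) k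
    have hmem : ∀ R, φ R ∈ Ici (0 : ℝ) := fun R => by simp only [hφ, mem_Ici]; positivity
    have hcomp : ConcaveOn ℝ (Ici 0) fun R => p • majorant p q k F Δ e C N (n + 1) (φ R) := by
      refine ConcaveOn.smul hp ⟨convex_Ici 0, fun R hR R' hR' a b ha hb hab => ?_⟩
      refine ((ih (n + 1)).2 (hmem R) (hmem R') ha hb hab).trans ?_
      refine majorant_monotoneOn hp hq hΔ hF N (n + 1) ?_ (hmem _) (hφc.2 hR hR' ha hb hab)
      exact convex_Ici 0 (hmem R) (hmem R') ha hb hab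
    exact hcomp.add (hFc.add_const (e n))

/-- By monotonicity the recursion can be unrolled along any sequence `B` that dominates one step of
the distance dynamics. -/
theorem majorant_le (hp : 0 ≤ p) (hq : 0 ≤ q) (hΔ : ∀ n, 0 ≤ Δ n)
    (hF : MonotoneOn F (Ici 0)) {B : ℕ → ℝ} (hB0 : ∀ n, 0 ≤ B n)
    (hB : ∀ n, (q * B n + Δ n) ^ 2 + k ^ 2 ≤ B (n + 1) ^ 2) (N : ℕ) :
    ∀ n, majorant p q k F Δ e C N n (B n ^ 2) ≤
      ∑ j ∈ Finset.range N, p ^ j * (F (B (n + j) ^ 2) + e (n + j)) + p ^ N * C := by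
  induction N with
  | zero => intro n; simp [majorant]
  | succ N ih =>
    intro n
    have h1 := majorant_monotoneOn (k := k) (C := C) (e := e) hp hq hΔ hF N (n + 1)
      (show (q * B n + Δ n) ^ 2 + k ^ 2 ∈ Ici (0 : ℝ) by simp only [mem_Ici]; positivity)
      (show _ ∈ Ici (0 : ℝ) from sq_nonneg (B (n + 1))) (hB n)
    have h2 := mul_le_mul_of_nonneg_left (h1.trans (ih (n + 1))) hp
    simp only [majorant, Real.sqrt_sq (hB0 n)]
    rw [Finset.sum_range_succ']
    have h3 : p * (∑ j ∈ Finset.range N, p ^ j * (F (B (n + 1 + j) ^ 2) + e (n + 1 + j)) +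
        p ^ N * C) = ∑ j ∈ Finset.range N, p ^ (j + 1) * (F (B (n + (j + 1)) ^ 2) +
          e (n + (j + 1))) + p ^ (N + 1) * C := by
      rw [mul_add, Finset.mul_sum]
      congr 1
      · refine Finset.sum_congr rfl fun j _ => ?_
        rw [show n + 1 + j = n + (j + 1) by ring]; ring
      · ring
    rw [h3] at h2
    simp only [pow_zero, one_mul, add_zero]
    linarith

/-- Jensen's inequality turns a one-step comparison into a comparison with the majorant. -/
theorem le_majorant {Z ι : Type*} {S : Set Z} {v D : ℕ → Z → ℝ} (hp : 0 ≤ p) (hq : 0 ≤ q)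
    (hΔ : ∀ n, 0 ≤ Δ n) (hF : MonotoneOn F (Ici 0)) (hFc : ConcaveOn ℝ (Ici 0) F)
    (hC : ∀ n, ∀ z ∈ S, v n z ≤ C) (hD : ∀ n, ∀ z ∈ S, 0 ≤ D n z)
    (hstep : ∀ n, ∀ z ∈ S, ∃ (s : Finset ι) (wt d : ι → ℝ) (z' : ι → Z),
      (∀ i ∈ s, z' i ∈ S) ∧ (∀ i ∈ s, 0 ≤ wt i) ∧ ∑ i ∈ s, wt i = 1 ∧ (∀ i ∈ s, 0 ≤ d i) ∧
      ∑ i ∈ s, wt i * d i ^ 2 ≤ D n z ^ 2 + k ^ 2 ∧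
      (∀ i ∈ s, D (n + 1) (z' i) ≤ q * d i + Δ n) ∧
      v n z ≤ ∑ i ∈ s, wt i * (p * v (n + 1) (z' i) + (F (d i ^ 2) + e n))) (N : ℕ) :
    ∀ n, ∀ z ∈ S, v n z ≤ majorant p q k F Δ e C N n (D n z ^ 2 + k ^ 2) := by
  induction N with
  | zero => exact hC
  | succ N ih =>
    intro n z hz
    obtain ⟨s, wt, d, z', hz', hwt, hsum, hd, hvar, hDs, hv⟩ := hstep n z hz
    have h1 : ∀ i ∈ s, p * v (n + 1) (z' i) + (F (d i ^ 2) + e n) ≤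
        majorant p q k F Δ e C (N + 1) n (d i ^ 2) := by
      intro i hi
      simp only [majorant, Real.sqrt_sq (hd i hi)]
      gcongr
      refine (ih (n + 1) (z' i) (hz' i hi)).trans ?_
      refine majorant_monotoneOn hp hq hΔ hF N (n + 1) ?_ ?_ ?_
      · simp only [mem_Ici]; positivity
      · simp only [mem_Ici]; positivity
      · have := hD (n + 1) (z' i) (hz' i hi)
        have := hDs i hi
        gcongr
    calc v n z ≤ _ := hv
      _ ≤ ∑ i ∈ s, wt i • majorant p q k F Δ e C (N + 1) n (d i ^ 2) :=
          Finset.sum_le_sum fun i hi => mul_le_mul_of_nonneg_left (h1 i hi) (hwt i hi)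
      _ ≤ majorant p q k F Δ e C (N + 1) n (∑ i ∈ s, wt i • d i ^ 2) :=
          (majorant_concaveOn hp hq hΔ hF hFc (N + 1) n).le_map_sum hwt hsum
            fun i _ => sq_nonneg (d i)
      _ ≤ _ := by
          refine majorant_monotoneOn hp hq hΔ hF (N + 1) n ?_ ?_ (by simpa using hvar)
          · exact mem_Ici.2 (Finset.sum_nonneg fun i hi =>
              mul_nonneg (hwt i hi) (sq_nonneg (d i)))
          · simp only [mem_Ici]; positivity

end majorant

/-! ### Growth of the mean distance and the comparison bound. -/

/-- The accumulated mean distance: drift errors add up, perturbations add up in mean square. -/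
theorem sq_growth_step {q k Δ S T : ℝ} {n : ℕ} (hq : 0 < q) (hΔ : 0 ≤ Δ) (hS : 0 ≤ S)
    (hT : 0 ≤ T) :
    (q * (q ^ n * (S + √T)) + Δ) ^ 2 + k ^ 2 ≤
      (q ^ (n + 1) * (S + Δ * (q⁻¹) ^ (n + 1) + √(T + k ^ 2 * ((q⁻¹) ^ 2) ^ (n + 1)))) ^ 2 := by
  set Q := q ^ (n + 1) with hQ
  have hQpos : 0 < Q := by positivity
  have hqi : (q⁻¹) ^ (n + 1) = Q⁻¹ := by rw [hQ, inv_pow]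
  have hqi2 : ((q⁻¹) ^ 2) ^ (n + 1) = (Q⁻¹) ^ 2 := by rw [← pow_mul, mul_comm, pow_mul, hqi]
  rw [hqi, hqi2]
  set U := √(T + k ^ 2 * (Q⁻¹) ^ 2) with hU
  have hU2 : U ^ 2 = T + k ^ 2 * (Q⁻¹) ^ 2 := Real.sq_sqrt (by positivity)
  have hT2 : √T ^ 2 = T := Real.sq_sqrt hT
  have hTU : √T ≤ U := Real.sqrt_le_sqrt (by nlinarith [sq_nonneg (k * Q⁻¹)])
  have e1 : q * (q ^ n * (S + √T)) + Δ = Q * (S + Δ * Q⁻¹ + √T) := by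
    rw [← mul_assoc, ← pow_succ', ← hQ]; field_simp; ring
  have e2 : k ^ 2 = Q ^ 2 * (U ^ 2 - √T ^ 2) := by
    rw [hU2, hT2]; field_simp; ring
  rw [e1, e2]
  have h3 : 0 ≤ S + Δ * Q⁻¹ := by positivity
  -- With `S' = S + Δ * Q⁻¹`, the claim is `(S' + √T) ^ 2 + U ^ 2 - T ≤ (S' + U) ^ 2`; the gap is
  -- the cross term `2 * S' * (U - √T)`.
  have h4 : 0 ≤ Q ^ 2 * (2 * (S + Δ * Q⁻¹) * (U - √T)) := by
    have : 0 ≤ U - √T := by linarith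
    positivity
  nlinarith

/-- After division by the growth factor `q ^ n`, the drift errors `κ * h ^ 2` form a series summing
to `κ * h / Lg`, the increments `δ j` contribute at most `κ * h`, and the variances sum to order `k
^ 2 / h`. -/
theorem growth_le {Lg κ h k : ℝ} {δ : ℕ → ℝ} (hLg : 0 < Lg) (hκ : 0 < κ) (hh : 0 < h)
    (hh1 : h ≤ 1) (hk : 0 < k) (hδ : ∀ n, 0 ≤ δ n) (hδ1 : ∀ N, ∑ n ∈ Finset.range N, δ n ≤ 1)
    (n : ℕ) :
    (∑ j ∈ Finset.range n, κ * h * (h + δ j) * ((1 + Lg * h)⁻¹) ^ (j + 1)) +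
      √(∑ j ∈ Finset.range (n + 1), k ^ 2 * (((1 + Lg * h)⁻¹) ^ 2) ^ j) ≤
    (κ / Lg + κ + (1 + Lg) / √Lg) * (h + k / √h) := by
  set q := 1 + Lg * h with hq
  have hq1 : 1 < q := by have := mul_pos hLg hh; rw [hq]; linarith
  have hq0 : 0 < q := by linarith
  have hqL : q ≤ 1 + Lg := by rw [hq]; nlinarith
  have hi0 : 0 < q⁻¹ := by positivity
  have hi1 : q⁻¹ < 1 := inv_lt_one_of_one_lt₀ hq1
  have hA : ∑ j ∈ Finset.range n, κ * h * (h + δ j) * (q⁻¹) ^ (j + 1) ≤ (κ / Lg + κ) * h := by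
    calc ∑ j ∈ Finset.range n, κ * h * (h + δ j) * (q⁻¹) ^ (j + 1)
        ≤ ∑ j ∈ Finset.range n, (κ * h * h * q⁻¹ * (q⁻¹) ^ j + κ * h * δ j) := by
          refine Finset.sum_le_sum fun j _ => ?_
          have h1 : (q⁻¹) ^ (j + 1) ≤ 1 := pow_le_one₀ hi0.le hi1.le
          have h2 : κ * h * δ j * (q⁻¹) ^ (j + 1) ≤ κ * h * δ j * 1 := by
            have := hδ j
            gcongr
          rw [pow_succ] at h2 ⊢
          nlinarith
      _ = κ * h * h * q⁻¹ * ∑ j ∈ Finset.range n, (q⁻¹) ^ j +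
            κ * h * ∑ j ∈ Finset.range n, δ j := by
          rw [Finset.sum_add_distrib, Finset.mul_sum, Finset.mul_sum]
      _ ≤ κ * h * h * q⁻¹ * (1 / (1 - q⁻¹)) + κ * h * 1 := by
          gcongr
          · exact sum_geometric_le hi0.le hi1 n
          · exact hδ1 n
      _ = (κ / Lg + κ) * h := by
          have : q⁻¹ * (1 / (1 - q⁻¹)) = 1 / (Lg * h) := by
            have h3 : q - 1 = Lg * h := by rw [hq]; ring
            have h4 : q - 1 ≠ 0 := by linarith
            rw [← h3]; field_simp
          rw [mul_assoc (κ * h * h), this]; field_simp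
  have hBs : √(∑ j ∈ Finset.range (n + 1), k ^ 2 * ((q⁻¹) ^ 2) ^ j) ≤
      (1 + Lg) / √Lg * (k / √h) := by
    have h5 : ∑ j ∈ Finset.range (n + 1), k ^ 2 * ((q⁻¹) ^ 2) ^ j ≤
        ((1 + Lg) * k) ^ 2 / (Lg * h) := by
      have h6 : ∑ j ∈ Finset.range (n + 1), ((q⁻¹) ^ 2) ^ j ≤ 1 / (1 - (q⁻¹) ^ 2) :=
        sum_geometric_le (by positivity) (by nlinarith) _
      have h7 : 1 / (1 - (q⁻¹) ^ 2) ≤ (1 + Lg) ^ 2 / (Lg * h) := by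
        have h8 : 1 / (1 - (q⁻¹) ^ 2) = q ^ 2 / (q ^ 2 - 1) := by
          have : q ^ 2 - 1 ≠ 0 := by nlinarith
          field_simp
        rw [h8]
        gcongr
        have : q - 1 = Lg * h := by rw [hq]; ring
        nlinarith
      rw [← Finset.mul_sum]
      calc k ^ 2 * _ ≤ k ^ 2 * ((1 + Lg) ^ 2 / (Lg * h)) := by gcongr; exact h6.trans h7
        _ = _ := by ring
    refine (Real.sqrt_le_sqrt h5).trans (le_of_eq ?_)
    rw [Real.sqrt_div (by positivity), Real.sqrt_sq (by positivity), Real.sqrt_mul hLg.le]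
    ring
  have hX : 0 ≤ k / √h := by positivity
  have h9 : 0 ≤ (1 + Lg) / √Lg := by positivity
  have h10 : 0 ≤ κ / Lg + κ := by positivity
  calc _ ≤ (κ / Lg + κ) * h + (1 + Lg) / √Lg * (k / √h) := add_le_add hA hBs
    _ ≤ _ := by nlinarith [mul_nonneg h9 hh.le, mul_nonneg h10 hX]

theorem sum_discounted_errors_le {lam κ h : ℝ} {δ : ℕ → ℝ} (hlam : 0 < lam) (hκ : 0 < κ)
    (hh : 0 < h) (hlh : lam * h < 1) (hδ : ∀ n, 0 ≤ δ n)
    (hδ1 : ∀ N, ∑ n ∈ Finset.range N, δ n ≤ 1) (N : ℕ) :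
    ∑ n ∈ Finset.range N, (1 - lam * h) ^ n * (κ * h * (h + δ n)) ≤ (κ / lam + κ) * h := by
  have hp : 0 < 1 - lam * h := by linarith
  have hp1 : 1 - lam * h < 1 := by have := mul_pos hlam hh; linarith
  calc ∑ n ∈ Finset.range N, (1 - lam * h) ^ n * (κ * h * (h + δ n))
      ≤ ∑ n ∈ Finset.range N, (κ * h * h * (1 - lam * h) ^ n + κ * h * δ n) := by
        refine Finset.sum_le_sum fun n _ => ?_
        have h1 : (1 - lam * h) ^ n ≤ 1 := pow_le_one₀ hp.le hp1.le
        have h2 : (κ * h * δ n) * (1 - lam * h) ^ n ≤ κ * h * δ n * 1 := by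
          have := hδ n
          gcongr
        nlinarith
    _ = κ * h * h * ∑ n ∈ Finset.range N, (1 - lam * h) ^ n +
          κ * h * ∑ n ∈ Finset.range N, δ n := by
        rw [Finset.sum_add_distrib, Finset.mul_sum, Finset.mul_sum]
    _ ≤ κ * h * h * (1 / (1 - (1 - lam * h))) + κ * h * 1 := by
        gcongr
        · exact sum_geometric_le hp.le hp1 N
        · exact hδ1 N
    _ = _ := by
        have : 1 - (1 - lam * h) = lam * h := by ring
        rw [this]; field_simp

theorem concaveOn_min_mul_sqrt {h G L : ℝ} (hh : 0 ≤ h) (hL : 0 ≤ L) :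
    ConcaveOn ℝ (Ici 0) fun R => h * min G (L * √R) := by
  have h1 : ConcaveOn ℝ (Ici (0 : ℝ)) fun R => L • √R :=
    Real.strictConcaveOn_sqrt.concaveOn.smul hL
  exact ((concaveOn_const G (convex_Ici 0)).inf h1).smul hh

theorem monotoneOn_min_mul_sqrt {h G L : ℝ} (hh : 0 ≤ h) (hL : 0 ≤ L) :
    MonotoneOn (fun R => h * min G (L * √R)) (Ici 0) := by
  intro R _ R' _ hRR
  dsimp only
  gcongr

theorem rpow_le_self_of_pow_le {h X γ : ℝ} (hh : 0 < h) (hh1 : h ≤ 1) (hX : h ≤ X) (h0 : 0 ≤ γ)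
    (h1 : γ ≤ 1) : h ≤ X ^ γ :=
  calc h = h ^ (1 : ℝ) := (Real.rpow_one h).symm
    _ ≤ h ^ γ := Real.rpow_le_rpow_of_exponent_ge hh hh1 h1
    _ ≤ X ^ γ := Real.rpow_le_rpow hh.le hX h0

/-- Comparison of a controlled random system of step `h` and mesh `k` with a deterministic one:
if `v` is a difference of values which satisfies a one-step comparison inequality with consistency
errors `κ h (h + δ n)`, then `v` is of order `(h + k / √h) ^ γ`. -/
theorem exists_comparison_bound {lam Lg Lf G κ γ : ℝ} (hγ : IsHolderExponent lam Lg γ)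
    (hlam : 0 < lam) (hLg : 0 < Lg) (hLf : 0 < Lf) (hG : 0 < G) (hκ : 0 < κ) :
    ∃ M : ℝ, 0 < M ∧ ∀ h k : ℝ, 0 < h → h ≤ 1 → lam * h < 1 → 0 < k →
      ∀ (Z ι : Type) (S : Set Z) (v D : ℕ → Z → ℝ) (δ : ℕ → ℝ),
      (∀ n, 0 ≤ δ n) → (∀ N, ∑ n ∈ Finset.range N, δ n ≤ 1) →
      (∃ C, ∀ n, ∀ z ∈ S, v n z ≤ C) → (∀ n, ∀ z ∈ S, 0 ≤ D n z) →
      (∀ n, ∀ z ∈ S, ∃ (s : Finset ι) (wt d : ι → ℝ) (z' : ι → Z),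
        (∀ i ∈ s, z' i ∈ S) ∧ (∀ i ∈ s, 0 ≤ wt i) ∧ ∑ i ∈ s, wt i = 1 ∧ (∀ i ∈ s, 0 ≤ d i) ∧
        ∑ i ∈ s, wt i * d i ^ 2 ≤ D n z ^ 2 + k ^ 2 ∧
        (∀ i ∈ s, D (n + 1) (z' i) ≤ (1 + Lg * h) * d i + κ * h * (h + δ n)) ∧
        v n z ≤ ∑ i ∈ s, wt i * ((1 - lam * h) * v (n + 1) (z' i) +
          (h * min G (Lf * d i) + κ * h * (h + δ n)))) →
      ∀ z ∈ S, D 0 z = 0 → v 0 z ≤ M * (h + k / √h) ^ γ := by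
  obtain ⟨C₁, hC₁, hsum⟩ := exists_discounted_sum_le hγ hlam hLg hG
  have h0 := hγ.pos hlam hLg
  have h1 := hγ.le_one hLg
  set c := Lf * (κ / Lg + κ + (1 + Lg) / √Lg) with hc
  have hcpos : 0 < c := by positivity
  refine ⟨C₁ * c ^ γ + (κ / lam + κ), by positivity, ?_⟩
  intro h k hh hh1 hlh hk Z ι S v D δ hδ hδ1 ⟨C, hC⟩ hD hstep z hz hDz
  have hp : 0 < 1 - lam * h := by linarith
  have hp1 : 1 - lam * h < 1 := by have := mul_pos hlam hh; linarith
  have hq : 0 < 1 + Lg * h := by positivity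
  set p := 1 - lam * h with hpdef
  set q := 1 + Lg * h with hqdef
  set F : ℝ → ℝ := fun R => h * min G (Lf * √R) with hF
  set Δ : ℕ → ℝ := fun n => κ * h * (h + δ n) with hΔdef
  have hΔ : ∀ n, 0 ≤ Δ n := fun n => by have := hδ n; simp only [hΔdef]; positivity
  have hFm : MonotoneOn F (Ici 0) := monotoneOn_min_mul_sqrt hh.le hLf.le
  have hFc : ConcaveOn ℝ (Ici 0) F := concaveOn_min_mul_sqrt hh.le hLf.le
  have hmaj := le_majorant (k := k) (F := F) (Δ := Δ) (e := Δ) (S := S) (v := v) (D := D) (C := C)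
    hp.le hq.le hΔ hFm hFc hC hD (by
      intro n z hz
      obtain ⟨s, wt, d, z', a1, a2, a3, a4, a5, a6, a7⟩ := hstep n z hz
      refine ⟨s, wt, d, z', a1, a2, a3, a4, a5, a6, a7.trans (le_of_eq ?_)⟩
      refine Finset.sum_congr rfl fun i hi => ?_
      simp only [hF, Real.sqrt_sq (a4 i hi), hΔdef])
  set A : ℕ → ℝ := fun n => ∑ j ∈ Finset.range n, Δ j * (q⁻¹) ^ (j + 1) with hA
  -- There are `n + 1` summands because `R` is measured after the perturbation: `T 0 = k ^ 2` is the
  -- jump at time zero, so `B 0 = k` although `D 0 z = 0`.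
  set T : ℕ → ℝ := fun n => ∑ j ∈ Finset.range (n + 1), k ^ 2 * ((q⁻¹) ^ 2) ^ j with hT
  set B : ℕ → ℝ := fun n => q ^ n * (A n + √(T n)) with hB
  have hA0 : ∀ n, 0 ≤ A n := fun n => Finset.sum_nonneg fun j _ => by
    have := hΔ j
    positivity
  have hT0 : ∀ n, 0 ≤ T n := fun n => Finset.sum_nonneg fun j _ => by positivity
  have hB0 : ∀ n, 0 ≤ B n := fun n => by
    have := hA0 n
    simp only [hB]; positivity
  have hBstep : ∀ n, (q * B n + Δ n) ^ 2 + k ^ 2 ≤ B (n + 1) ^ 2 := by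
    intro n
    have := sq_growth_step (k := k) (n := n) hq (hΔ n) (hA0 n) (hT0 n)
    simp only [hB]
    rwa [show A (n + 1) = A n + Δ n * (q⁻¹) ^ (n + 1) from Finset.sum_range_succ _ _,
      show T (n + 1) = T n + k ^ 2 * ((q⁻¹) ^ 2) ^ (n + 1) from Finset.sum_range_succ _ _]
  set X := h + k / √h with hX
  have hXpos : 0 < X := by positivity
  have hBle : ∀ n, Lf * B n ≤ c * X * q ^ n := by
    intro n
    have := growth_le hLg hκ hh hh1 hk hδ hδ1 n
    calc Lf * B n = Lf * q ^ n * (A n + √(T n)) := by simp only [hB]; ring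
      _ ≤ Lf * q ^ n * ((κ / Lg + κ + (1 + Lg) / √Lg) * X) := by gcongr
      _ = _ := by rw [hc]; ring
  have hmain : ∀ N : ℕ, v 0 z ≤ (C₁ * c ^ γ + (κ / lam + κ)) * X ^ γ + p ^ N * C := by
    intro N
    have hB00 : D 0 z ^ 2 + k ^ 2 = B 0 ^ 2 := by
      simp only [hB, hA, hT, hDz]
      simp [Real.sqrt_sq hk.le]
    have e1 := hmaj N 0 z hz
    rw [hB00] at e1
    refine e1.trans ((majorant_le hp.le hq.le hΔ hFm hB0 hBstep N 0).trans ?_)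
    gcongr
    simp only [zero_add, mul_add, Finset.sum_add_distrib, add_mul]
    rw [← add_mul]
    refine add_le_add ?_ ?_
    · calc ∑ n ∈ Finset.range N, p ^ n * F (B n ^ 2)
          ≤ ∑ n ∈ Finset.range N, h * p ^ n * min G (c * X * q ^ n) := by
            refine Finset.sum_le_sum fun n _ => ?_
            simp only [hF, Real.sqrt_sq (hB0 n)]
            rw [mul_left_comm, ← mul_assoc]
            have := hBle n
            gcongr
        _ ≤ C₁ * (c * X) ^ γ := hsum h (c * X) hh hh1 hlh (by positivity) N
        _ = C₁ * c ^ γ * X ^ γ := by rw [Real.mul_rpow hcpos.le hXpos.le]; ring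
    · refine (sum_discounted_errors_le hlam hκ hh hlh hδ hδ1 N).trans ?_
      have : h ≤ X ^ γ := rpow_le_self_of_pow_le hh hh1 (by
        rw [hX]; have : 0 ≤ k / √h := by positivity
        linarith) h0.le h1
      gcongr
  -- As `N → ∞` the discount removes the crude bound `C` at the final time, so `M` does not depend
  -- on `C`.
  have hlim : Filter.Tendsto (fun N : ℕ => (C₁ * c ^ γ + (κ / lam + κ)) * X ^ γ + p ^ N * C)
      Filter.atTop (nhds ((C₁ * c ^ γ + (κ / lam + κ)) * X ^ γ + 0 * C)) :=
    ((tendsto_pow_atTop_nhds_zero_of_lt_one hp.le hp1).mul_const C).const_add _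
  rw [zero_mul, add_zero] at hlim
  exact ge_of_tendsto' hlim hmain

/-! ### Barycentric coordinates and piecewise affine interpolation. -/

variable {ν : ℕ}

theorem AffineMap.map_sum_of_sum_eq_one (A : E ν →ᵃ[ℝ] ℝ) {s : Finset (E ν)} {wt : E ν → ℝ}
    (hsum : ∑ i ∈ s, wt i = 1) : A (∑ i ∈ s, wt i • i) = ∑ i ∈ s, wt i * A i := by
  have h : ∀ x, A x = A.linear x + A 0 := fun x => congrFun A.decomp x
  have h' : ∑ i ∈ s, wt i * A i = ∑ i ∈ s, (wt i * A.linear i + wt i * A 0) :=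
    Finset.sum_congr rfl fun i _ => by rw [h i, mul_add]
  rw [h, map_sum, h', Finset.sum_add_distrib, ← Finset.sum_mul, hsum, one_mul]
  simp only [map_smul, smul_eq_mul]

/-- The vertices are completed to an affine basis; the required map is the combination of its
coordinates with coefficients `V`. -/
theorem exists_affineMap_eq_on {s : Finset (E ν)} (hs : AffineIndependent ℝ ((↑) : s → E ν))
    (V : E ν → ℝ) : ∃ A : E ν →ᵃ[ℝ] ℝ, ∀ i ∈ s, A i = V i := by
  obtain ⟨t, hst, hti, htop⟩ := exists_subset_affineIndependent_affineSpan_eq_top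
    (k := ℝ) (s := (s : Set (E ν))) hs
  have : Finite t := finite_of_fin_dim_affineIndependent ℝ hti
  have := Fintype.ofFinite t
  classical
  let b : AffineBasis t ℝ (E ν) := ⟨fun p => p, hti, by simpa using htop⟩
  let φ : (t → ℝ) →ₗ[ℝ] ℝ := ∑ i : t, V i • LinearMap.proj i
  refine ⟨φ.toAffineMap.comp b.coords, fun i hi => ?_⟩
  have hb : b ⟨i, hst hi⟩ = i := rfl
  have hc : ∀ j : t, b.coords i j = if j = ⟨i, hst hi⟩ then 1 else 0 := by
    intro j
    rw [AffineBasis.coords_apply]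
    conv_lhs => rw [← hb]
    rw [AffineBasis.coord_apply]
  simp [φ, hc]

/-- The variance of a convex combination of points at distance at most `k` of their mean. -/
theorem sum_mul_sq_norm_sub_le {s : Finset (E ν)} {wt : E ν → ℝ} {x : E ν} {k : ℝ}
    (hwt : ∀ i ∈ s, 0 ≤ wt i) (hsum : ∑ i ∈ s, wt i = 1) (hx : ∑ i ∈ s, wt i • i = x)
    (hk : ∀ i ∈ s, ‖i - x‖ ≤ k) (y : E ν) :
    ∑ i ∈ s, wt i * ‖i - y‖ ^ 2 ≤ ‖x - y‖ ^ 2 + k ^ 2 := by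
  have h1 : ∀ i, ‖i - y‖ ^ 2 = ‖i - x‖ ^ 2 + 2 * inner ℝ (i - x) (x - y) + ‖x - y‖ ^ 2 := by
    intro i
    rw [← norm_add_sq_real, sub_add_sub_cancel]
  -- The mean of the vertices is `x`, so the cross term vanishes. This cancellation makes the error
  -- `k ^ 2` in mean square.
  have h2 : ∑ i ∈ s, wt i * (2 * inner ℝ (i - x) (x - y)) = 0 := by
    have h3 : ∑ i ∈ s, wt i • (i - x) = 0 := by
      simp_rw [smul_sub, Finset.sum_sub_distrib, ← Finset.sum_smul, hsum, hx, one_smul, sub_self]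
    calc ∑ i ∈ s, wt i * (2 * inner ℝ (i - x) (x - y))
        = 2 * inner ℝ (∑ i ∈ s, wt i • (i - x)) (x - y) := by
          rw [sum_inner, Finset.mul_sum]
          refine Finset.sum_congr rfl fun i _ => ?_
          rw [real_inner_smul_left]; ring
      _ = 0 := by rw [h3, inner_zero_left, mul_zero]
  have h4 : ∑ i ∈ s, wt i * ‖i - x‖ ^ 2 ≤ k ^ 2 := by
    calc ∑ i ∈ s, wt i * ‖i - x‖ ^ 2 ≤ ∑ i ∈ s, wt i * k ^ 2 :=
          Finset.sum_le_sum fun i hi => by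
            have := hwt i hi
            have := hk i hi
            gcongr
      _ = k ^ 2 := by rw [← Finset.sum_mul, hsum, one_mul]
  have h5 : ∑ i ∈ s, wt i * ‖i - y‖ ^ 2 = ∑ i ∈ s, (wt i * ‖i - x‖ ^ 2 +
      wt i * (2 * inner ℝ (i - x) (x - y)) + wt i * ‖x - y‖ ^ 2) :=
    Finset.sum_congr rfl fun i _ => by rw [h1 i]; ring
  rw [h5, Finset.sum_add_distrib, Finset.sum_add_distrib, h2, ← Finset.sum_mul, hsum]
  linarith

section Complex

variable {K : Geometry.SimplicialComplex ℝ (E ν)}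

/-- Barycentric coordinates in a face. -/
theorem exists_barycentric {x : E ν} (hx : x ∈ K.space) :
    ∃ s ∈ K.faces, ∃ wt : E ν → ℝ, (∀ i ∈ s, 0 ≤ wt i) ∧ ∑ i ∈ s, wt i = 1 ∧
      ∑ i ∈ s, wt i • i = x := by
  obtain ⟨s, hs, hxs⟩ := Geometry.SimplicialComplex.mem_space_iff.1 hx
  exact ⟨s, hs, Finset.mem_convexHull'.1 hxs⟩

theorem mem_vertices_of_mem_face {s : Finset (E ν)} (hs : s ∈ K.faces) {i : E ν} (hi : i ∈ s) :
    i ∈ K.vertices := by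
  rw [Geometry.SimplicialComplex.vertices_eq]
  exact mem_biUnion hs hi

theorem finite_vertices (hK : K.faces.Finite) : K.vertices.Finite := by
  rw [Geometry.SimplicialComplex.vertices_eq]
  exact hK.biUnion fun s _ => s.finite_toSet

theorem IsTriangulation.norm_sub_le {Ω : Set (E ν)} {k : ℝ} (hK : IsTriangulation Ω K k)
    {s : Finset (E ν)} (hs : s ∈ K.faces) {x y : E ν} (hx : x ∈ convexHull ℝ (s : Set (E ν)))
    (hy : y ∈ convexHull ℝ (s : Set (E ν))) : ‖x - y‖ ≤ k := by
  obtain ⟨t, ht, hst, hcard⟩ := hK.pure s hs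
  have hsub : convexHull ℝ (s : Set (E ν)) ⊆ convexHull ℝ (t : Set (E ν)) :=
    convexHull_mono (by exact_mod_cast hst)
  rw [← dist_eq_norm]
  exact (Metric.dist_le_diam_of_mem (isBounded_convexHull.2 t.finite_toSet.isBounded)
    (hsub hx) (hsub hy)).trans (hK.mesh.2 ⟨t, ht, hcard, rfl⟩)

theorem IsFiniteElement.eq_sum {h : ℝ} {w : E ν → ℝ → ℝ} (hw : IsFiniteElement K h w)
    {a : ℝ} (ha : a ∈ controlGrid h) {s : Finset (E ν)} (hs : s ∈ K.faces) {wt : E ν → ℝ}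
    (hwt : ∀ i ∈ s, 0 ≤ wt i) (hsum : ∑ i ∈ s, wt i = 1) :
    w (∑ i ∈ s, wt i • i) a = ∑ i ∈ s, wt i * w i a := by
  obtain ⟨A, hA⟩ := hw.affine a ha s hs
  rw [hA _ (Finset.mem_convexHull'.2 ⟨wt, hwt, hsum, rfl⟩), AffineMap.map_sum_of_sum_eq_one A hsum]
  exact Finset.sum_congr rfl fun i hi => by rw [hA i (subset_convexHull ℝ _ hi)]

/-- Values interpolated in a face do not depend on the face. -/
theorem sum_mul_eq_affineMap {s t : Finset (E ν)} (hs : s ∈ K.faces) (ht : t ∈ K.faces)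
    {wt V : E ν → ℝ} (hwt : ∀ i ∈ s, 0 ≤ wt i) (hsum : ∑ i ∈ s, wt i = 1)
    (hxt : ∑ i ∈ s, wt i • i ∈ convexHull ℝ (t : Set (E ν))) {A : E ν →ᵃ[ℝ] ℝ}
    (hA : ∀ i ∈ t, A i = V i) :
    ∑ i ∈ s, wt i * V i = A (∑ i ∈ s, wt i • i) := by
  classical
  obtain ⟨As, hAs⟩ := exists_affineMap_eq_on (K.indep hs) V
  have hxs : ∑ i ∈ s, wt i • i ∈ convexHull ℝ (s : Set (E ν)) :=
    Finset.mem_convexHull'.2 ⟨wt, hwt, hsum, rfl⟩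
  -- In a simplicial complex the point lies in the hull of the common vertices, where both affine
  -- maps take the values `V`.
  have hxst := K.inter_subset_convexHull hs ht ⟨hxs, hxt⟩
  rw [← Finset.coe_inter] at hxst
  obtain ⟨wt', -, hsum', hx'⟩ := Finset.mem_convexHull'.1 hxst
  calc ∑ i ∈ s, wt i * V i = As (∑ i ∈ s, wt i • i) := by
        rw [AffineMap.map_sum_of_sum_eq_one As hsum]
        exact Finset.sum_congr rfl fun i hi => by rw [hAs i hi]
    _ = A (∑ i ∈ s, wt i • i) := by
        rw [← hx', AffineMap.map_sum_of_sum_eq_one As hsum',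
          AffineMap.map_sum_of_sum_eq_one A hsum']
        refine Finset.sum_congr rfl fun i hi => ?_
        rw [Finset.mem_inter] at hi
        rw [hAs i hi.1, hA i hi.2]

theorem continuousOn_space {u : E ν → ℝ} (hK : K.faces.Finite)
    (hu : ∀ s ∈ K.faces, ∃ A : E ν →ᵃ[ℝ] ℝ, ∀ x ∈ convexHull ℝ (s : Set (E ν)), u x = A x) :
    ContinuousOn u K.space := by
  have : Finite K.faces := hK
  have hsp : K.space = ⋃ s : K.faces, convexHull ℝ ((s : Finset (E ν)) : Set (E ν)) := by
    rw [Geometry.SimplicialComplex.space, biUnion_eq_iUnion]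
  rw [hsp]
  refine (locallyFinite_of_finite _).continuousOn_iUnion
    (fun s => s.1.finite_toSet.isClosed_convexHull ℝ) fun s => ?_
  obtain ⟨A, hA⟩ := hu s s.2
  exact A.continuous_of_finiteDimensional.continuousOn.congr hA

/-- The piecewise affine interpolation of nodal values. -/
theorem exists_interpolation (K : Geometry.SimplicialComplex ℝ (E ν)) :
    ∃ (σ : E ν → Finset (E ν)) (β : E ν → E ν → ℝ),
      (∀ x ∈ K.space, σ x ∈ K.faces ∧ (∀ i ∈ σ x, 0 ≤ β x i) ∧ ∑ i ∈ σ x, β x i = 1) ∧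
      (∀ V : E ν → ℝ, ∀ s ∈ K.faces, ∃ A : E ν →ᵃ[ℝ] ℝ, (∀ i ∈ s, A i = V i) ∧
        ∀ x ∈ convexHull ℝ (s : Set (E ν)), ∑ i ∈ σ x, β x i * V i = A x) := by
  have h : ∀ x : E ν, ∃ (s : Finset (E ν)) (wt : E ν → ℝ), x ∈ K.space → s ∈ K.faces ∧
      (∀ i ∈ s, 0 ≤ wt i) ∧ ∑ i ∈ s, wt i = 1 ∧ ∑ i ∈ s, wt i • i = x := by
    intro x
    by_cases hx : x ∈ K.space
    · obtain ⟨s, hs, wt, h⟩ := exists_barycentric hx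
      exact ⟨s, wt, fun _ => ⟨hs, h⟩⟩
    · exact ⟨∅, 0, fun h => absurd h hx⟩
  choose σ β hσ using h
  refine ⟨σ, β, fun x hx => ⟨(hσ x hx).1, (hσ x hx).2.1, (hσ x hx).2.2.1⟩, fun V s hs => ?_⟩
  obtain ⟨A, hA⟩ := exists_affineMap_eq_on (K.indep hs) V
  refine ⟨A, hA, fun x hx => ?_⟩
  obtain ⟨h1, h2, h3, h4⟩ := hσ x (Geometry.SimplicialComplex.convexHull_subset_space hs hx)
  have := sum_mul_eq_affineMap h1 hs h2 h3 (by rwa [h4]) hA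
  rwa [h4] at this

end Complex

/-! ### Existence and uniqueness of the discrete solution. -/

theorem finite_controlGrid (h : ℝ) : (controlGrid h).Finite := by
  refine ((Finset.range (⌊1 / h⌋₊ + 1)).finite_toSet.image fun i : ℕ => (i : ℝ) * h).subset ?_
  rintro b ⟨i, hi, rfl⟩
  refine ⟨i, ?_, rfl⟩
  simp only [Finset.coe_range, mem_Iio]
  exact Nat.lt_succ_of_le (Nat.le_floor hi)

theorem controlGrid_subset_Icc {h : ℝ} (hh : 0 < h) : controlGrid h ⊆ Icc 0 1 := by
  rintro b ⟨i, hi, rfl⟩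
  exact ⟨by positivity, by rwa [le_div_iff₀ hh] at hi⟩

theorem self_mem_controlGridFrom {h a : ℝ} (hh : 0 < h) (ha : a ∈ controlGrid h) :
    a ∈ controlGridFrom h a :=
  ⟨ha, le_rfl, (controlGrid_subset_Icc hh ha).2⟩

theorem abs_sub_le_of_isLeast_image {φ ψ : ℝ → ℝ} {S : Set ℝ} {m m' c : ℝ}
    (hm : IsLeast (φ '' S) m) (hm' : IsLeast (ψ '' S) m')
    (hc : ∀ b ∈ S, |φ b - ψ b| ≤ c) : |m - m'| ≤ c := by
  obtain ⟨⟨b, hb, rfl⟩, h1⟩ := hm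
  obtain ⟨⟨b', hb', rfl⟩, h2⟩ := hm'
  have e1 := h1 ⟨b', hb', rfl⟩
  have e2 := h2 ⟨b, hb, rfl⟩
  have e3 := abs_le.1 (hc b hb)
  have e4 := abs_le.1 (hc b' hb')
  rw [abs_le]
  constructor <;> linarith

theorem abs_timeStep_sub_le {g : E ν → ℝ → E ν} {f : E ν → ℝ → ℝ} {lam h a b m : ℝ} {x : E ν}
    {w w' : E ν → ℝ → ℝ} (hlh : lam * h < 1)
    (hm : |w (x + h • g x a) b - w' (x + h • g x a) b| ≤ m) :
    |timeStep g f lam h b w x a - timeStep g f lam h b w' x a| ≤ (1 - lam * h) * m := by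
  have h1 : 0 < 1 - lam * h := by linarith
  have : timeStep g f lam h b w x a - timeStep g f lam h b w' x a =
      (1 - lam * h) * (w (x + h • g x a) b - w' (x + h • g x a) b) := by
    simp only [timeStep]; ring
  rw [this, abs_mul, abs_of_pos h1]
  gcongr

theorem abs_sum_mul_sub_le {s : Finset (E ν)} {wt V V' : E ν → ℝ} {m : ℝ}
    (hwt : ∀ i ∈ s, 0 ≤ wt i) (hsum : ∑ i ∈ s, wt i = 1) (hm : ∀ i ∈ s, |V i - V' i| ≤ m) :
    |∑ i ∈ s, wt i * V i - ∑ i ∈ s, wt i * V' i| ≤ m := by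
  rw [← Finset.sum_sub_distrib]
  calc |∑ i ∈ s, (wt i * V i - wt i * V' i)| ≤ ∑ i ∈ s, |wt i * V i - wt i * V' i| :=
        Finset.abs_sum_le_sum_abs _ _
    _ ≤ ∑ i ∈ s, wt i * m := Finset.sum_le_sum fun i hi => by
        rw [← mul_sub, abs_mul, abs_of_nonneg (hwt i hi)]
        exact mul_le_mul_of_nonneg_left (hm i hi) (hwt i hi)
    _ = m := by rw [← Finset.sum_mul, hsum, one_mul]

/-- The difference of two solutions is largest at a node, by convex combination. There the Bellman
equation contracts it by the factor `1 - lam * h`, since minima are nonexpansive. -/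
theorem IsFullyDiscreteSolution.eq_of_eq {Ω : Set (E ν)} {g : E ν → ℝ → E ν} {f : E ν → ℝ → ℝ}
    {lam k h : ℝ} {K : Geometry.SimplicialComplex ℝ (E ν)} (hlam : 0 < lam)
    (hd : IsDiscretization Ω g lam K k h) {w w' : E ν → ℝ → ℝ}
    (hw : IsFullyDiscreteSolution g f lam K h w) (hw' : IsFullyDiscreteSolution g f lam K h w')
    {x : E ν} (hx : x ∈ K.space) {a : ℝ} (ha : a ∈ controlGrid h) : w x a = w' x a := by
  have hfin : (K.vertices ×ˢ controlGrid h).Finite :=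
    (finite_vertices hd.triangulation.finite).prod (finite_controlGrid h)
  have hne : (K.vertices ×ˢ controlGrid h).Nonempty := by
    obtain ⟨s, hs, -⟩ := exists_barycentric hx
    obtain ⟨i, hi⟩ := Geometry.SimplicialComplex.nonempty_of_mem_faces hs
    exact ⟨(i, a), mem_vertices_of_mem_face hs hi, ha⟩
  obtain ⟨⟨x₀, a₀⟩, ⟨hx₀, ha₀⟩, hmax⟩ := exists_max_image (K.vertices ×ˢ controlGrid h)
    (fun z => |w z.1 z.2 - w' z.1 z.2|) hfin hne
  have hle : ∀ x ∈ K.space, ∀ a ∈ controlGrid h, |w x a - w' x a| ≤ |w x₀ a₀ - w' x₀ a₀| := by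
    intro x hx a ha
    obtain ⟨s, hs, wt, h1, h2, rfl⟩ := exists_barycentric hx
    rw [hw.1.eq_sum ha hs h1 h2, hw'.1.eq_sum ha hs h1 h2]
    exact abs_sum_mul_sub_le h1 h2 fun i hi => hmax (i, a) ⟨mem_vertices_of_mem_face hs hi, ha⟩
  have hcontr : |w x₀ a₀ - w' x₀ a₀| ≤ (1 - lam * h) * |w x₀ a₀ - w' x₀ a₀| :=
    abs_sub_le_of_isLeast_image (hw.2.nodal x₀ hx₀ a₀ ha₀) (hw'.2.nodal x₀ hx₀ a₀ ha₀)
      fun b hb => abs_timeStep_sub_le hd.step_small (hle _ (hd.stable x₀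
        (Geometry.SimplicialComplex.vertices_subset_space hx₀) a₀ ha₀) b hb.1)
  have h1 : 0 < lam * h := mul_pos hlam hd.step_pos
  have h2 : |w x₀ a₀ - w' x₀ a₀| ≤ 0 := by
    by_contra hcon
    have := mul_pos h1 (not_le.1 hcon)
    linarith
  exact sub_eq_zero.1 (abs_nonpos_iff.1 ((hle x hx a ha).trans h2))

/-- Banach's fixed point theorem on the finite-dimensional space of nodal values with the sup norm;
interpolation is nonexpansive for it. -/
theorem exists_isFullyDiscreteSolution {Ω : Set (E ν)} {g : E ν → ℝ → E ν} {f : E ν → ℝ → ℝ}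
    {lam k h : ℝ} {K : Geometry.SimplicialComplex ℝ (E ν)} (hlam : 0 < lam)
    (hd : IsDiscretization Ω g lam K k h) : ∃ w, IsFullyDiscreteSolution g f lam K h w := by
  classical
  obtain ⟨σ, β, hσ, hI⟩ := exists_interpolation K
  have : Finite K.vertices := finite_vertices hd.triangulation.finite
  have : Finite (controlGrid h) := finite_controlGrid h
  have := Fintype.ofFinite (K.vertices × controlGrid h)
  let ext : (K.vertices × controlGrid h → ℝ) → E ν → ℝ → ℝ := fun V x a =>
    if hxa : x ∈ K.vertices ∧ a ∈ controlGrid h then V (⟨x, hxa.1⟩, ⟨a, hxa.2⟩) else 0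
  let W : (K.vertices × controlGrid h → ℝ) → E ν → ℝ → ℝ := fun V x a =>
    ∑ i ∈ σ x, β x i * ext V i a
  let T : (K.vertices × controlGrid h → ℝ) → (K.vertices × controlGrid h → ℝ) := fun V z =>
    sInf ((fun b => timeStep g f lam h b (W V) z.1 z.2) '' controlGridFrom h z.2)
  have hT : ∀ V z, IsLeast ((fun b => timeStep g f lam h b (W V) z.1 z.2) ''
      controlGridFrom h z.2) (T V z) := by
    intro V z
    have hfin : ((fun b => timeStep g f lam h b (W V) z.1 z.2) '' controlGridFrom h z.2).Finite :=
      ((finite_controlGrid h).subset inter_subset_left).image _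
    have hne : ((fun b => timeStep g f lam h b (W V) z.1 z.2) '' controlGridFrom h z.2).Nonempty :=
      ⟨_, z.2, self_mem_controlGridFrom hd.step_pos z.2.2, rfl⟩
    exact ⟨hne.csInf_mem hfin, fun c hc => csInf_le hfin.bddBelow hc⟩
  have hWW : ∀ V V', ∀ x ∈ K.space, ∀ a ∈ controlGrid h, |W V x a - W V' x a| ≤ dist V V' := by
    intro V V' x hx a ha
    obtain ⟨h1, h2, h3⟩ := hσ x hx
    refine abs_sum_mul_sub_le h2 h3 fun i hi => ?_
    have hi' : i ∈ K.vertices ∧ a ∈ controlGrid h := ⟨mem_vertices_of_mem_face h1 hi, ha⟩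
    simp only [ext, dif_pos hi']
    rw [← Real.dist_eq]
    exact dist_le_pi_dist V V' _
  have h1 : 0 < 1 - lam * h := by linarith [hd.step_small]
  have hcontr : ContractingWith (Real.toNNReal (1 - lam * h)) T := by
    refine ⟨?_, LipschitzWith.of_dist_le_mul fun V V' => ?_⟩
    · rw [← NNReal.coe_lt_coe, Real.coe_toNNReal _ h1.le]
      have := mul_pos hlam hd.step_pos
      simp only [NNReal.coe_one]
      linarith
    · rw [Real.coe_toNNReal _ h1.le, dist_pi_le_iff (by positivity)]
      intro z
      rw [Real.dist_eq]
      exact abs_sub_le_of_isLeast_image (hT V z) (hT V' z) fun b hb =>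
        abs_timeStep_sub_le hd.step_small (hWW V V' _ (hd.stable z.1
          (Geometry.SimplicialComplex.vertices_subset_space z.1.2) z.2 z.2.2) b hb.1)
  set V := hcontr.fixedPoint T with hV
  have hfix : T V = V := hcontr.fixedPoint_isFixedPt
  have haff : ∀ a ∈ controlGrid h, ∀ s ∈ K.faces, ∃ A : E ν →ᵃ[ℝ] ℝ,
      ∀ x ∈ convexHull ℝ (s : Set (E ν)), W V x a = A x := by
    intro a _ s hs
    obtain ⟨A, -, hA⟩ := hI (fun i => ext V i a) s hs
    exact ⟨A, hA⟩
  have hfe : IsFiniteElement K h (W V) :=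
    ⟨fun a ha => continuousOn_space hd.triangulation.finite (haff a ha), haff⟩
  refine ⟨W V, hfe, hfe, fun x hx a ha => ?_⟩
  -- Interpolating in the face `{x}` shows that nodal values are reproduced.
  have hval : W V x a = V (⟨x, hx⟩, ⟨a, ha⟩) := by
    obtain ⟨A, hA1, hA2⟩ := hI (fun i => ext V i a) {x} hx
    have e1 : W V x a = A x := hA2 x (by simp)
    rw [e1, hA1 x (by simp)]
    simp only [ext, dif_pos (And.intro hx ha)]
  have e2 := hT V (⟨x, hx⟩, ⟨a, ha⟩)
  rw [hfix] at e2
  rw [hval]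
  exact e2

/-! ### Paths, measurability and cost. -/

/-- `φ(x,a)` is Lipschitz continuous with constant `L` and bounded by `M` on `Ω × [0,1]`. -/
structure IsLipschitzBounded {F : Type*} [NormedAddCommGroup F] (Ω : Set (E ν))
    (φ : E ν → ℝ → F) (L M : ℝ) : Prop where
  lip : ∀ x ∈ Ω, ∀ x' ∈ Ω, ∀ a ∈ Icc (0 : ℝ) 1, ∀ a' ∈ Icc (0 : ℝ) 1,
    ‖φ x a - φ x' a'‖ ≤ L * (‖x - x'‖ + |a - a'|)
  bdd : ∀ x ∈ Ω, ∀ a ∈ Icc (0 : ℝ) 1, ‖φ x a‖ ≤ M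

/-- A continuous path in `Ω` together with a monotone control. -/
structure IsPath (Ω : Set (E ν)) (α : ℝ → ℝ) (y : ℝ → E ν) : Prop where
  continuousOn : ContinuousOn y (Ici 0)
  mem : ∀ t, 0 ≤ t → y t ∈ Ω
  monotoneOn : MonotoneOn α (Ici 0)
  mem_Icc : ∀ s, 0 ≤ s → α s ∈ Icc (0 : ℝ) 1

theorem IsControl.mono {a b : ℝ} {α : ℝ → ℝ} (h : IsControl b α) (hab : a ≤ b) : IsControl a α :=
  ⟨h.monotoneOn, h.mem_Icc, hab.trans h.le_initial⟩

theorem isControl_const {a : ℝ} (ha : a ∈ Icc (0 : ℝ) 1) : IsControl a fun _ => a :=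
  ⟨fun _ _ _ _ _ => le_rfl, fun _ _ => ha, le_rfl⟩

theorem continuousOn_shift {y : ℝ → E ν} (hy : ContinuousOn y (Ici 0)) {t : ℝ} (ht : 0 ≤ t) :
    ContinuousOn (fun s => y (s + t)) (Ici 0) :=
  hy.comp (by fun_prop) fun s hs => by
    have : 0 ≤ s := hs
    exact mem_Ici.2 (by linarith)

theorem IsTrajectory.isPath {Ω : Set (E ν)} {g : E ν → ℝ → E ν} {x : E ν} {a : ℝ} {α : ℝ → ℝ}
    {y : ℝ → E ν} (hy : IsTrajectory Ω g x α y) (hα : IsControl a α) : IsPath Ω α y :=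
  ⟨hy.continuousOn, hy.mem, hα.monotoneOn, hα.mem_Icc⟩

theorem IsTrajectory.initial {Ω : Set (E ν)} {g : E ν → ℝ → E ν} {x : E ν} {α : ℝ → ℝ}
    {y : ℝ → E ν} (hy : IsTrajectory Ω g x α y) : y 0 = x := by
  simpa using hy.eq_integral 0 le_rfl

section Measurability

variable {F : Type*} [NormedAddCommGroup F] [MeasurableSpace F] [BorelSpace F]
  [SecondCountableTopology F] {Ω : Set (E ν)} {φ : E ν → ℝ → F} {L M : ℝ} {α : ℝ → ℝ} {y : ℝ → E ν}

/-- `φ` is controlled only on `Ω × [0,1]`, where it is continuous; its extension by zero is Borel.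
The path is continuous and the control monotone, hence both are measurable on `[0,∞)`. -/
theorem IsLipschitzBounded.aestronglyMeasurable (hφ : IsLipschitzBounded Ω φ L M) (hL : 0 ≤ L)
    (hΩ : IsOpen Ω) (hp : IsPath Ω α y) :
    AEStronglyMeasurable (fun s => φ (y s) (α s)) (volume.restrict (Ici 0)) := by
  classical
  have hc : ContinuousOn (fun z : E ν × ℝ => φ z.1 z.2) (Ω ×ˢ Icc 0 1) := by
    rw [Metric.continuousOn_iff]
    intro z hz ε hε
    refine ⟨ε / (2 * L + 1), by positivity, fun z' hz' hd => ?_⟩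
    have h1 := hφ.lip z'.1 hz'.1 z.1 hz.1 z'.2 hz'.2 z.2 hz.2
    have h2 : ‖z'.1 - z.1‖ ≤ dist z' z := by
      rw [← dist_eq_norm]; exact le_max_left _ _
    have h3 : |z'.2 - z.2| ≤ dist z' z := by
      rw [← Real.dist_eq]; exact le_max_right _ _
    rw [dist_eq_norm]
    calc ‖φ z'.1 z'.2 - φ z.1 z.2‖ ≤ L * (dist z' z + dist z' z) := h1.trans (by gcongr)
      _ ≤ (2 * L + 1) * dist z' z := by nlinarith [dist_nonneg (x := z') (y := z)]
      _ < (2 * L + 1) * (ε / (2 * L + 1)) := by gcongr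
      _ = ε := by field_simp
  have hmeas : Measurable ((Ω ×ˢ Icc (0 : ℝ) 1).piecewise (fun z : E ν × ℝ => φ z.1 z.2)
      fun _ => 0) :=
    hc.measurable_piecewise continuousOn_const (hΩ.measurableSet.prod measurableSet_Icc)
  have hya : AEMeasurable (fun s => (y s, α s)) (volume.restrict (Ici 0)) :=
    (hp.continuousOn.aemeasurable measurableSet_Ici).prodMk
      (aemeasurable_restrict_of_monotoneOn measurableSet_Ici hp.monotoneOn)
  refine ((hmeas.comp_aemeasurable hya).congr ?_).aestronglyMeasurable
  refine (ae_restrict_iff' measurableSet_Ici).2 (ae_of_all _ fun s hs => ?_)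
  exact Set.piecewise_eq_of_mem _ _ _ (show (y s, α s) ∈ Ω ×ˢ Icc (0 : ℝ) 1 from
    ⟨hp.mem s hs, hp.mem_Icc s hs⟩)

theorem IsLipschitzBounded.intervalIntegrable (hφ : IsLipschitzBounded Ω φ L M) (hL : 0 ≤ L)
    (hΩ : IsOpen Ω) (hp : IsPath Ω α y) {s t : ℝ} (hs : 0 ≤ s) (ht : 0 ≤ t) :
    IntervalIntegrable (fun s => φ (y s) (α s)) volume s t := by
  have hsub : uIoc s t ⊆ Ici 0 := fun r hr => (le_min hs ht).trans hr.1.le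
  rw [intervalIntegrable_iff]
  refine ⟨(hφ.aestronglyMeasurable hL hΩ hp).mono_measure (Measure.restrict_mono hsub le_rfl),
    .restrict_of_bounded (C := M) (by simp [uIoc]) ?_⟩
  refine (ae_restrict_iff' measurableSet_uIoc).2 (ae_of_all _ fun r hr => ?_)
  exact hφ.bdd _ (hp.mem r (hsub hr)) _ (hp.mem_Icc r (hsub hr))

end Measurability

section Cost

variable {Ω : Set (E ν)} {f : E ν → ℝ → ℝ} {lam Lf Mf : ℝ} {α : ℝ → ℝ} {y : ℝ → E ν}

theorem IsPath.shift (hp : IsPath Ω α y) {t : ℝ} (ht : 0 ≤ t) :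
    IsPath Ω (fun s => α (s + t)) fun s => y (s + t) := by
  refine ⟨continuousOn_shift hp.continuousOn ht, fun s hs => hp.mem _ (by linarith),
    fun s hs s' hs' hss => ?_, fun s hs => hp.mem_Icc _ (by linarith)⟩
  have h1 : 0 ≤ s := hs
  have h2 : 0 ≤ s' := hs'
  exact hp.monotoneOn (mem_Ici.2 (by linarith)) (mem_Ici.2 (by linarith)) (by linarith)

theorem integrableOn_cost (hf : IsLipschitzBounded Ω f Lf Mf) (hLf : 0 ≤ Lf) (hΩ : IsOpen Ω)
    (hlam : 0 < lam) (hp : IsPath Ω α y) :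
    IntegrableOn (fun s => f (y s) (α s) * Real.exp (-lam * s)) (Ioi 0) := by
  refine Integrable.bdd_mul (c := Mf) (integrableOn_exp_mul_Ioi (by linarith) 0)
    ((hf.aestronglyMeasurable hLf hΩ hp).mono_measure
      (Measure.restrict_mono Ioi_subset_Ici_self le_rfl)) ?_
  refine (ae_restrict_iff' measurableSet_Ioi).2 (ae_of_all _ fun r hr => ?_)
  have hr' : 0 ≤ r := (mem_Ioi.1 hr).le
  exact hf.bdd _ (hp.mem r hr') _ (hp.mem_Icc r hr')

theorem abs_cost_le (hf : IsLipschitzBounded Ω f Lf Mf) (hlam : 0 < lam) (hp : IsPath Ω α y) :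
    |cost f lam α y| ≤ Mf / lam := by
  have h1 : ‖∫ s in Ioi (0 : ℝ), f (y s) (α s) * Real.exp (-lam * s)‖ ≤
      ∫ s in Ioi (0 : ℝ), Mf * Real.exp (-lam * s) := by
    refine norm_integral_le_of_norm_le
      ((integrableOn_exp_mul_Ioi (by linarith) 0).const_mul Mf) ?_
    refine (ae_restrict_iff' measurableSet_Ioi).2 (ae_of_all _ fun r hr => ?_)
    have hr' : 0 ≤ r := (mem_Ioi.1 hr).le
    rw [norm_mul, Real.norm_of_nonneg (Real.exp_pos _).le]
    gcongr
    exact hf.bdd _ (hp.mem r hr') _ (hp.mem_Icc r hr')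
  have h2 : ∫ s in Ioi (0 : ℝ), Mf * Real.exp (-lam * s) = Mf / lam := by
    rw [integral_const_mul, integral_exp_mul_Ioi (by linarith) 0]
    simp [div_eq_mul_inv]
  rw [h2] at h1
  exact h1

theorem cost_eq_add (hf : IsLipschitzBounded Ω f Lf Mf) (hLf : 0 ≤ Lf) (hΩ : IsOpen Ω)
    (hlam : 0 < lam) (hp : IsPath Ω α y) {h : ℝ} (hh : 0 ≤ h) :
    cost f lam α y = (∫ s in (0 : ℝ)..h, f (y s) (α s) * Real.exp (-lam * s)) +
      Real.exp (-lam * h) * cost f lam (fun s => α (s + h)) fun s => y (s + h) := by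
  have hi := integrableOn_cost hf hLf hΩ hlam hp
  have h1 := intervalIntegral.integral_interval_add_Ioi hi
    (hi.mono_set (Ioi_subset_Ioi hh))
  have h2 := (measurePreserving_add_right (volume : Measure ℝ) h).setIntegral_preimage_emb
    (measurableEmbedding_addRight h) (fun s => f (y s) (α s) * Real.exp (-lam * s)) (Ioi h)
  simp only [preimage_add_const_Ioi, sub_self] at h2
  rw [cost, cost, ← h1, ← h2, ← integral_const_mul]
  congr 2
  ext s
  rw [mul_left_comm, ← Real.exp_add]
  congr 3
  ring

end Cost

/-! ### One-step consistency and concatenation of trajectories. -/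

section OneStep

variable {Ω : Set (E ν)} {g : E ν → ℝ → E ν} {f : E ν → ℝ → ℝ} {lam Lg Mg Lf Mf : ℝ}
  {x : E ν} {α : ℝ → ℝ} {y : ℝ → E ν}

theorem IsTrajectory.shift (hg : IsLipschitzBounded Ω g Lg Mg) (hLg : 0 ≤ Lg) (hΩ : IsOpen Ω)
    (hy : IsTrajectory Ω g x α y) {a : ℝ} (hα : IsControl a α) {t : ℝ} (ht : 0 ≤ t) :
    IsTrajectory Ω g (y t) (fun s => α (s + t)) fun s => y (s + t) := by
  have hp := hy.isPath hα
  refine ⟨continuousOn_shift hp.continuousOn ht, fun s hs => hp.mem _ (by linarith),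
    fun s hs => ?_⟩
  rw [hy.eq_integral _ (by linarith), hy.eq_integral t ht,
    intervalIntegral.integral_comp_add_right (fun s => g (y s) (α s)), zero_add, add_assoc,
    intervalIntegral.integral_add_adjacent_intervals
      (hg.intervalIntegrable hLg hΩ hp le_rfl ht)
      (hg.intervalIntegrable hLg hΩ hp ht (by linarith))]

theorem IsTrajectory.norm_sub_initial_le (hg : IsLipschitzBounded Ω g Lg Mg)
    (hp : IsPath Ω α y) (hy : IsTrajectory Ω g x α y) {t : ℝ} (ht : 0 ≤ t) :
    ‖y t - x‖ ≤ Mg * t := by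
  rw [hy.eq_integral t ht, add_sub_cancel_left]
  have : ‖∫ s in (0 : ℝ)..t, g (y s) (α s)‖ ≤ Mg * |t - 0| := by
    refine intervalIntegral.norm_integral_le_of_norm_le_const fun s hs => ?_
    rw [uIoc_of_le ht] at hs
    exact hg.bdd _ (hp.mem s hs.1.le) _ (hp.mem_Icc s hs.1.le)
  rwa [sub_zero, abs_of_nonneg ht] at this

theorem norm_apply_sub_le {F : Type*} [NormedAddCommGroup F] {φ : E ν → ℝ → F} {L M : ℝ}
    (hφ : IsLipschitzBounded Ω φ L M) (hL : 0 ≤ L) (hg : IsLipschitzBounded Ω g Lg Mg)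
    (hMg : 0 ≤ Mg) (hx : x ∈ Ω) (hp : IsPath Ω α y)
    (hy : IsTrajectory Ω g x α y) {a δ h s : ℝ} (ha : a ∈ Icc (0 : ℝ) 1) (hs : 0 ≤ s) (hsh : s ≤ h)
    (hδ : |α s - a| ≤ δ) : ‖φ (y s) (α s) - φ x a‖ ≤ L * (Mg * h + δ) := by
  have h1 := hφ.lip _ (hp.mem s hs) x hx _ (hp.mem_Icc s hs) a ha
  have h2 := hy.norm_sub_initial_le hg hp hs
  have h3 : Mg * s ≤ Mg * h := by gcongr
  exact h1.trans (mul_le_mul_of_nonneg_left (by linarith) hL)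

/-- On `[0,h]` the path moves by at most `Mg * h` and the control stays within `δ` of `a`, so the
velocity differs from `g x a` by at most `Lg * (Mg * h + δ)`. -/
theorem IsTrajectory.norm_sub_euler_le (hg : IsLipschitzBounded Ω g Lg Mg) (hLg : 0 ≤ Lg)
    (hMg : 0 ≤ Mg) (hΩ : IsOpen Ω) (hx : x ∈ Ω) (hp : IsPath Ω α y) (hy : IsTrajectory Ω g x α y)
    {a δ h : ℝ} (ha : a ∈ Icc (0 : ℝ) 1) (hh : 0 ≤ h)
    (hδ : ∀ s, 0 ≤ s → s ≤ h → |α s - a| ≤ δ) :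
    ‖y h - (x + h • g x a)‖ ≤ h * (Lg * (Mg * h + δ)) := by
  have h1 : y h - (x + h • g x a) = ∫ s in (0 : ℝ)..h, (g (y s) (α s) - g x a) := by
    rw [intervalIntegral.integral_sub (hg.intervalIntegrable hLg hΩ hp le_rfl hh)
      (by simp), intervalIntegral.integral_const, sub_zero, hy.eq_integral h hh]
    abel
  have h2 : ‖∫ s in (0 : ℝ)..h, (g (y s) (α s) - g x a)‖ ≤ Lg * (Mg * h + δ) * |h - 0| := by
    refine intervalIntegral.norm_integral_le_of_norm_le_const fun s hs => ?_
    rw [uIoc_of_le hh] at hs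
    exact norm_apply_sub_le hg hLg hg hMg hx hp hy ha hs.1.le hs.2 (hδ s hs.1.le hs.2)
  rw [h1]
  rw [sub_zero, abs_of_nonneg hh] at h2
  linarith

/-- Three errors add up: the variation of `f` along the path, the discount within the step (at most
`Mf * lam * h` per unit time), and the replacement of `exp (-lam * h)` by `1 - lam * h`, which costs
`(lam * h) ^ 2` times the bound `Mf / lam` on the remaining cost. -/
theorem abs_cost_sub_le (hf : IsLipschitzBounded Ω f Lf Mf) (hLf : 0 ≤ Lf) (hMf : 0 ≤ Mf)
    (hg : IsLipschitzBounded Ω g Lg Mg) (hMg : 0 ≤ Mg) (hΩ : IsOpen Ω)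
    (hlam : 0 < lam) (hx : x ∈ Ω) (hp : IsPath Ω α y) (hy : IsTrajectory Ω g x α y)
    {a δ h : ℝ} (ha : a ∈ Icc (0 : ℝ) 1) (hh : 0 ≤ h) (hlh : lam * h < 1)
    (hδ : ∀ s, 0 ≤ s → s ≤ h → |α s - a| ≤ δ) :
    |cost f lam α y - (h * f x a +
      (1 - lam * h) * cost f lam (fun s => α (s + h)) fun s => y (s + h))| ≤
      h * (Lf * (Mg * h + δ) + 2 * Mf * lam * h) := by
  set J := cost f lam (fun s => α (s + h)) fun s => y (s + h) with hJ
  have hJle : |J| ≤ Mf / lam := abs_cost_le hf hlam (hp.shift hh)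
  have hlh0 : 0 ≤ lam * h := by positivity
  have hexp : |Real.exp (-lam * h) - (1 - lam * h)| ≤ (lam * h) ^ 2 := by
    have := Real.abs_exp_sub_one_sub_id_le (x := -lam * h)
      (by rw [neg_mul, abs_neg, abs_of_nonneg hlh0]; exact hlh.le)
    have e : Real.exp (-lam * h) - 1 - -lam * h = Real.exp (-lam * h) - (1 - lam * h) := by ring
    rw [e] at this
    calc _ ≤ _ := this
      _ = _ := by ring
  have hint : IntervalIntegrable (fun s => f (y s) (α s) * Real.exp (-lam * s)) volume 0 h :=
    (hf.intervalIntegrable hLf hΩ hp le_rfl hh).mul_continuousOn (by fun_prop)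
  have h1 : |(∫ s in (0 : ℝ)..h, f (y s) (α s) * Real.exp (-lam * s)) - h * f x a| ≤
      h * (Lf * (Mg * h + δ) + Mf * lam * h) := by
    have e1 : (∫ s in (0 : ℝ)..h, f (y s) (α s) * Real.exp (-lam * s)) - h * f x a =
        ∫ s in (0 : ℝ)..h, (f (y s) (α s) * Real.exp (-lam * s) - f x a) := by
      rw [intervalIntegral.integral_sub hint (by simp), intervalIntegral.integral_const, sub_zero,
        smul_eq_mul]
    have e2 : ‖∫ s in (0 : ℝ)..h, (f (y s) (α s) * Real.exp (-lam * s) - f x a)‖ ≤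
        (Lf * (Mg * h + δ) + Mf * lam * h) * |h - 0| := by
      refine intervalIntegral.norm_integral_le_of_norm_le_const fun s hs => ?_
      rw [uIoc_of_le hh] at hs
      have e3 := norm_apply_sub_le hf hLf hg hMg hx hp hy ha hs.1.le hs.2 (hδ s hs.1.le hs.2)
      have e4 : |f (y s) (α s)| ≤ Mf := hf.bdd _ (hp.mem s hs.1.le) _ (hp.mem_Icc s hs.1.le)
      have e5 : |Real.exp (-lam * s) - 1| ≤ lam * h := by
        have e6 : Real.exp (-lam * s) ≤ 1 := Real.exp_le_one_iff.2 (by nlinarith [hs.1])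
        have e7 := Real.add_one_le_exp (-lam * s)
        have e8 : lam * s ≤ lam * h := mul_le_mul_of_nonneg_left hs.2 hlam.le
        rw [abs_le]
        constructor <;> linarith
      have e9 : f (y s) (α s) * Real.exp (-lam * s) - f x a =
          (f (y s) (α s) - f x a) + f (y s) (α s) * (Real.exp (-lam * s) - 1) := by ring
      rw [e9]
      refine (norm_add_le _ _).trans (add_le_add e3 ?_)
      rw [norm_mul, mul_assoc]
      exact mul_le_mul e4 e5 (abs_nonneg _) hMf
    rw [e1]
    rw [sub_zero, abs_of_nonneg hh, Real.norm_eq_abs] at e2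
    linarith
  have h2 : |(Real.exp (-lam * h) - (1 - lam * h)) * J| ≤ h * (Mf * lam * h) := by
    rw [abs_mul]
    calc _ ≤ (lam * h) ^ 2 * (Mf / lam) := mul_le_mul hexp hJle (abs_nonneg _) (by positivity)
      _ = _ := by field_simp
  rw [cost_eq_add hf hLf hΩ hlam hp hh]
  have e : (∫ s in (0 : ℝ)..h, f (y s) (α s) * Real.exp (-lam * s)) + Real.exp (-lam * h) * J -
      (h * f x a + (1 - lam * h) * J) =
      ((∫ s in (0 : ℝ)..h, f (y s) (α s) * Real.exp (-lam * s)) - h * f x a) +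
        (Real.exp (-lam * h) - (1 - lam * h)) * J := by ring
  rw [e]
  refine (abs_add_le _ _).trans ((add_le_add h1 h2).trans (le_of_eq (by ring)))

/-- The control `a` is kept up to time `h`, where the control `β` takes over. -/
def concatControl (h a : ℝ) (β : ℝ → ℝ) : ℝ → ℝ := fun s => if s ≤ h then a else β (s - h)

/-- The path `y` is followed up to time `h`, where the path `z` takes over. -/
def concatPath (h : ℝ) (y z : ℝ → E ν) : ℝ → E ν :=
  fun s => y (min s h) + (z (max (s - h) 0) - z 0)

theorem isControl_concatControl {h a b : ℝ} {β : ℝ → ℝ} (hh : 0 ≤ h) (ha : a ∈ Icc (0 : ℝ) 1)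
    (hab : a ≤ b) (hβ : IsControl b β) : IsControl a (concatControl h a β) := by
  refine ⟨fun s _ s' _ hss => ?_, fun s _ => ?_, by simp [concatControl, hh]⟩
  · simp only [concatControl]
    split_ifs with h1 h2 h2
    · exact le_rfl
    · exact (hab.trans hβ.le_initial).trans (hβ.monotoneOn (mem_Ici.2 le_rfl)
        (mem_Ici.2 (by linarith)) (by linarith))
    · exact absurd (hss.trans h2) h1
    · exact hβ.monotoneOn (mem_Ici.2 (by linarith)) (mem_Ici.2 (by linarith)) (by linarith)
  · simp only [concatControl]
    split_ifs with h1
    · exact ha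
    · exact hβ.mem_Icc _ (by linarith)

theorem isTrajectory_concat (hg : IsLipschitzBounded Ω g Lg Mg) (hLg : 0 ≤ Lg) (hΩ : IsOpen Ω)
    {h a b : ℝ} (hh : 0 ≤ h) (ha : a ∈ Icc (0 : ℝ) 1) {β : ℝ → ℝ} (hβ : IsControl b β)
    {z : ℝ → E ν} (hy : IsTrajectory Ω g x (fun _ => a) y) (hz : IsTrajectory Ω g (y h) β z) :
    IsTrajectory Ω g x (concatControl h a β) (concatPath h y z) := by
  have hle : ∀ s, s ≤ h → concatPath h y z s = y s := fun s hs => by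
    simp [concatPath, min_eq_left hs, max_eq_right (sub_nonpos.2 hs)]
  have hge : ∀ s, h ≤ s → concatPath h y z s = z (s - h) := fun s hs => by
    simp [concatPath, min_eq_right hs, max_eq_left (sub_nonneg.2 hs), hz.initial]
  have hfirst : ∀ t, 0 ≤ t → t ≤ h → ∫ s in (0 : ℝ)..t, g (concatPath h y z s)
      (concatControl h a β s) = ∫ s in (0 : ℝ)..t, g (y s) a := by
    intro t ht hth
    refine intervalIntegral.integral_congr fun s hs => ?_
    rw [uIcc_of_le ht] at hs
    have hsh := hs.2.trans hth
    simp only [hle s hsh, concatControl, if_pos hsh]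
  refine ⟨?_, fun t ht => ?_, fun t ht => ?_⟩
  -- The clamped times `min s h` and `max (s - h) 0` make each summand continuous on the whole
  -- half-line, with no gluing at `h`.
  · refine ContinuousOn.add ?_ (ContinuousOn.sub ?_ continuousOn_const)
    · exact hy.continuousOn.comp (by fun_prop) fun s hs => mem_Ici.2 (le_min hs hh)
    · exact hz.continuousOn.comp (by fun_prop) fun s _ => mem_Ici.2 (le_max_right _ _)
  · rcases le_total t h with hth | hth
    · rw [hle t hth]; exact hy.mem t ht
    · rw [hge t hth]; exact hz.mem _ (by linarith)
  · rcases le_total t h with hth | hth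
    · rw [hle t hth, hfirst t ht hth]; exact hy.eq_integral t ht
    · have hsecond : ∀ s ∈ uIoc h t, g (concatPath h y z s) (concatControl h a β s) =
          g (z (s - h)) (β (s - h)) := by
        intro s hs
        rw [uIoc_of_le hth] at hs
        simp only [hge s hs.1.le, concatControl, if_neg (not_le.2 hs.1)]
      have hint1 : IntervalIntegrable (fun s => g (concatPath h y z s) (concatControl h a β s))
          volume 0 h := by
        refine (hg.intervalIntegrable hLg hΩ (hy.isPath (isControl_const ha)) le_rfl hh).congr
          fun s hs => ?_
        rw [uIoc_of_le hh] at hs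
        simp only [hle s hs.2, concatControl, if_pos hs.2]
      have hint2 : IntervalIntegrable (fun s => g (concatPath h y z s) (concatControl h a β s))
          volume h t := by
        have := (hg.intervalIntegrable hLg hΩ (hz.isPath hβ) le_rfl
          (sub_nonneg.2 hth)).comp_sub_right h
        rw [zero_add, sub_add_cancel] at this
        exact this.congr fun s hs => (hsecond s hs).symm
      rw [← intervalIntegral.integral_add_adjacent_intervals hint1 hint2, hfirst h hh le_rfl,
        intervalIntegral.integral_congr_ae (ae_of_all _ hsecond),
        intervalIntegral.integral_comp_sub_right (fun s => g (z s) (β s)), sub_self, ← add_assoc,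
        ← hy.eq_integral h hh, hge t hth]
      exact hz.eq_integral _ (sub_nonneg.2 hth)

theorem cost_concat_shift {h a : ℝ} {β : ℝ → ℝ} {z : ℝ → E ν} (hz : z 0 = y h) :
    (cost f lam (fun s => concatControl h a β (s + h)) fun s => concatPath h y z (s + h)) =
      cost f lam β z := by
  refine setIntegral_congr_fun measurableSet_Ioi fun s hs => ?_
  -- Strict positivity matters: at `s = 0` the concatenated control still equals `a`.
  have hs' : 0 < s := hs
  have h1 : concatControl h a β (s + h) = β s := by
    simp [concatControl, not_le.2 hs']
  have h2 : concatPath h y z (s + h) = z s := by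
    simp [concatPath, hs'.le, hz]
  simp only [h1, h2]

end OneStep

/-! ### The value function and dynamic programming. -/

section Value

variable {Ω : Set (E ν)} {g : E ν → ℝ → E ν} {f : E ν → ℝ → ℝ} {lam Lg Mg Lf Mf : ℝ} {x : E ν}

theorem bddBelow_costs (hf : IsLipschitzBounded Ω f Lf Mf) (hlam : 0 < lam) (x : E ν) (a : ℝ) :
    BddBelow {c : ℝ | ∃ (α : ℝ → ℝ) (y : ℝ → E ν),
      IsControl a α ∧ IsTrajectory Ω g x α y ∧ c = cost f lam α y} := by
  refine ⟨-(Mf / lam), ?_⟩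
  rintro c ⟨α, y, hα, hy, rfl⟩
  exact (abs_le.1 (abs_cost_le hf hlam (hy.isPath hα))).1

theorem value_le_cost (hf : IsLipschitzBounded Ω f Lf Mf) (hlam : 0 < lam) {a : ℝ}
    {α : ℝ → ℝ} {y : ℝ → E ν} (hα : IsControl a α) (hy : IsTrajectory Ω g x α y) :
    value Ω g f lam x a ≤ cost f lam α y :=
  csInf_le (bddBelow_costs hf hlam x a) ⟨α, y, hα, hy, rfl⟩

theorem le_value (hviable : ∀ x ∈ Ω, ∀ α : ℝ → ℝ, IsControl 0 α →
      ∃ y : ℝ → E ν, IsTrajectory Ω g x α y) (hx : x ∈ Ω) {a c : ℝ} (ha : a ∈ Icc (0 : ℝ) 1)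
    (hc : ∀ α y, IsControl a α → IsTrajectory Ω g x α y → c ≤ cost f lam α y) :
    c ≤ value Ω g f lam x a := by
  -- A constant control makes the set of costs nonempty; the infimum of the empty set would be `0`
  -- by convention.
  have hα := isControl_const ha
  obtain ⟨y, hy⟩ := hviable x hx _ (hα.mono ha.1)
  refine le_csInf ⟨_, _, y, hα, hy, rfl⟩ ?_
  rintro _ ⟨α, y, hα, hy, rfl⟩
  exact hc α y hα hy

theorem value_le (hf : IsLipschitzBounded Ω f Lf Mf) (hlam : 0 < lam)
    (hviable : ∀ x ∈ Ω, ∀ α : ℝ → ℝ, IsControl 0 α → ∃ y : ℝ → E ν, IsTrajectory Ω g x α y)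
    (hx : x ∈ Ω) {a : ℝ} (ha : a ∈ Icc (0 : ℝ) 1) : value Ω g f lam x a ≤ Mf / lam := by
  have hα := isControl_const ha
  obtain ⟨y, hy⟩ := hviable x hx _ (hα.mono ha.1)
  exact (value_le_cost hf hlam hα hy).trans (abs_le.1 (abs_cost_le hf hlam (hy.isPath hα))).2

/-- One half of the dynamic programming principle, with the control `a` on `[0,h]`. -/
theorem value_le_step (hf : IsLipschitzBounded Ω f Lf Mf) (hLf : 0 ≤ Lf) (hMf : 0 ≤ Mf)
    (hg : IsLipschitzBounded Ω g Lg Mg) (hLg : 0 ≤ Lg) (hMg : 0 ≤ Mg) (hΩ : IsOpen Ω)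
    (hlam : 0 < lam)
    (hviable : ∀ x ∈ Ω, ∀ α : ℝ → ℝ, IsControl 0 α → ∃ y : ℝ → E ν, IsTrajectory Ω g x α y)
    (hx : x ∈ Ω) {a b h : ℝ} (ha : a ∈ Icc (0 : ℝ) 1) (hb : b ∈ Icc (0 : ℝ) 1) (hab : a ≤ b)
    (hh : 0 ≤ h) (hlh : lam * h < 1) {y : ℝ → E ν} (hy : IsTrajectory Ω g x (fun _ => a) y) :
    value Ω g f lam x a ≤ h * f x a + (1 - lam * h) * value Ω g f lam (y h) b +
      h * (Lf * (Mg * h) + 2 * Mf * lam * h) := by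
  have hp : 0 < 1 - lam * h := by linarith
  set e := h * (Lf * (Mg * h) + 2 * Mf * lam * h) with he
  -- Since `1 - lam * h > 0`, the claim becomes a lower bound for the value at `y h`, to be tested
  -- on each control `β` appended after time `h`.
  have h1 : (value Ω g f lam x a - h * f x a - e) / (1 - lam * h) ≤ value Ω g f lam (y h) b := by
    refine le_value hviable (hy.mem h hh) hb fun β z hβ hz => ?_
    have hα := isControl_concatControl hh ha hab hβ
    have ht := isTrajectory_concat hg hLg hΩ hh ha hβ hy hz
    have h2 := value_le_cost hf hlam hα ht
    have h3 := abs_cost_sub_le hf hLf hMf hg hMg hΩ hlam hx (ht.isPath hα) ht ha hh hlh (δ := 0)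
      (fun s _ hs => by simp [concatControl, hs])
    rw [cost_concat_shift hz.initial, add_zero] at h3
    have h4 := (abs_le.1 h3).2
    rw [div_le_iff₀ hp]
    linarith
  rw [div_le_iff₀ hp] at h1
  linarith

end Value

/-! ### Upper estimate of the value function. -/

variable {Ω : Set (E ν)} {g : E ν → ℝ → E ν} {f : E ν → ℝ → ℝ}
  {lam Lg Mg Lf Mf γ k h : ℝ} {K : Geometry.SimplicialComplex ℝ (E ν)} {w : E ν → ℝ → ℝ}

theorem IsDiscretization.step_le_one (hd : IsDiscretization Ω g lam K k h) : h ≤ 1 := by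
  obtain ⟨m, hm⟩ := hd.step_inv
  have h1 : 0 < 1 / h := one_div_pos.2 hd.step_pos
  rw [hm, Nat.cast_pos] at h1
  have h2 : (1 : ℝ) ≤ 1 / h := by rw [hm]; exact_mod_cast h1
  rwa [le_div_iff₀ hd.step_pos, one_mul] at h2

theorem IsFiniteElement.exists_abs_le (hw : IsFiniteElement K h w) (hK : K.faces.Finite) :
    ∃ C, ∀ x ∈ K.space, ∀ a ∈ controlGrid h, |w x a| ≤ C := by
  obtain ⟨C, hC⟩ := (((finite_vertices hK).prod (finite_controlGrid h)).image
    fun z => |w z.1 z.2|).bddAbove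
  refine ⟨C, fun x hx a ha => ?_⟩
  obtain ⟨s, hs, wt, h1, h2, rfl⟩ := exists_barycentric hx
  have := abs_sum_mul_sub_le (V := fun i => w i a) (V' := fun _ => 0) h1 h2 (m := C)
    fun i hi => by
      rw [sub_zero]
      exact hC ⟨(i, a), ⟨mem_vertices_of_mem_face hs hi, ha⟩, rfl⟩
  rw [hw.eq_sum ha hs h1 h2]
  simpa using this

theorem abs_sub_le_min (hf : IsLipschitzBounded Ω f Lf Mf) {x y : E ν} (hx : x ∈ Ω) (hy : y ∈ Ω)
    {a : ℝ} (ha : a ∈ Icc (0 : ℝ) 1) : |f x a - f y a| ≤ min (2 * Mf) (Lf * ‖x - y‖) := by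
  refine le_min ?_ ?_
  · have h1 : |f x a| ≤ Mf := hf.bdd x hx a ha
    have h2 : |f y a| ≤ Mf := hf.bdd y hy a ha
    linarith [abs_sub (f x a) (f y a)]
  · simpa using hf.lip x hx y hy a ha a ha

theorem norm_euler_sub_le (hg : IsLipschitzBounded Ω g Lg Mg) {x y : E ν}
    (hx : x ∈ Ω) (hy : y ∈ Ω) {a : ℝ} (ha : a ∈ Icc (0 : ℝ) 1) (hh : 0 ≤ h) :
    ‖(x + h • g x a) - (y + h • g y a)‖ ≤ (1 + Lg * h) * ‖x - y‖ := by
  have h1 : (x + h • g x a) - (y + h • g y a) = (x - y) + h • (g x a - g y a) := by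
    rw [smul_sub]; abel
  have h2 : ‖g x a - g y a‖ ≤ Lg * ‖x - y‖ := by simpa using hg.lip x hx y hy a ha a ha
  rw [h1]
  calc _ ≤ ‖x - y‖ + h * ‖g x a - g y a‖ := by
        refine (norm_add_le _ _).trans ?_
        rw [norm_smul, Real.norm_of_nonneg hh]
    _ ≤ ‖x - y‖ + h * (Lg * ‖x - y‖) := by gcongr
    _ = _ := by ring

/-- Barycentric coordinates in a face of the triangulation, with the resulting estimate of the mean
square distance to an arbitrary point. -/
theorem IsTriangulation.exists_barycentric (hK : IsTriangulation Ω K k) {x : E ν}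
    (hx : x ∈ K.space) :
    ∃ (s : Finset (E ν)) (wt : E ν → ℝ), (∀ i ∈ s, i ∈ K.vertices) ∧ (∀ i ∈ s, 0 ≤ wt i) ∧
      ∑ i ∈ s, wt i = 1 ∧ (∀ y, ∑ i ∈ s, wt i * ‖i - y‖ ^ 2 ≤ ‖x - y‖ ^ 2 + k ^ 2) ∧
      ∀ h w, IsFiniteElement K h w → ∀ a ∈ controlGrid h, w x a = ∑ i ∈ s, wt i * w i a := by
  obtain ⟨s, hs, wt, h1, h2, h3⟩ := MonotoneControl.exists_barycentric hx
  refine ⟨s, wt, fun i hi => mem_vertices_of_mem_face hs hi, h1, h2,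
    sum_mul_sq_norm_sub_le h1 h2 h3 fun i hi => ?_, fun h w hw a ha => ?_⟩
  · exact hK.norm_sub_le hs (subset_convexHull ℝ _ hi) (Finset.mem_convexHull'.2 ⟨wt, h1, h2, h3⟩)
  · rw [← h3, hw.eq_sum ha hs h1 h2]

/-- The comparison runs on triples of discrete position, continuous position and current control.
The continuous system holds the control for time `h` and then adopts the discrete minimizer, so the
control errors `δ` are zero. -/
theorem exists_value_sub_le (hf : IsLipschitzBounded Ω f Lf Mf) (hLf : 0 < Lf) (hMf : 0 < Mf)
    (hg : IsLipschitzBounded Ω g Lg Mg) (hLg : 0 < Lg) (hMg : 0 < Mg) (hΩ : IsOpen Ω)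
    (hlam : 0 < lam)
    (hviable : ∀ x ∈ Ω, ∀ α : ℝ → ℝ, IsControl 0 α → ∃ y : ℝ → E ν, IsTrajectory Ω g x α y)
    (hγ : IsHolderExponent lam Lg γ) :
    ∃ M : ℝ, 0 < M ∧ ∀ (K : Geometry.SimplicialComplex ℝ (E ν)) (k h : ℝ),
      IsDiscretization Ω g lam K k h → ∀ w, IsFullyDiscreteSolution g f lam K h w →
      ∀ x ∈ K.space, ∀ a ∈ controlGrid h, value Ω g f lam x a - w x a ≤ M * (h + k / √h) ^ γ := by
  obtain ⟨M, hM, hbound⟩ := exists_comparison_bound (Lf := Lf) (G := 2 * Mf)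
    (κ := Lg * (Mg + 1) + Lf * (Mg + 1) + 2 * Mf * lam) hγ hlam hLg hLf (by positivity)
    (by positivity)
  refine ⟨M, hM, fun K k h hd w hw x hx a ha => ?_⟩
  have hh := hd.step_pos
  have hsub := hd.triangulation.space_subset
  have hgrid := controlGrid_subset_Icc hh
  obtain ⟨C, hC⟩ := hw.1.exists_abs_le hd.triangulation.finite
  refine hbound h k hh hd.step_le_one hd.step_small hd.mesh_pos (E ν × E ν × ℝ) (E ν)
    {z | z.1 ∈ K.space ∧ z.2.1 ∈ Ω ∧ z.2.2 ∈ controlGrid h}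
    (fun _ z => value Ω g f lam z.2.1 z.2.2 - w z.1 z.2.2) (fun _ z => ‖z.1 - z.2.1‖)
    (fun _ => 0) (fun _ => le_rfl) (fun N => by simp) ⟨Mf / lam + C, ?_⟩ (fun _ _ _ => norm_nonneg _)
    ?_ (x, x, a) ⟨hx, hsub hx, ha⟩ (by simp)
  · rintro - ⟨x, y, a⟩ ⟨hx, hy, ha⟩
    have h1 := value_le hf hlam hviable hy (hgrid ha)
    have h2 := abs_le.1 (hC x hx a ha)
    dsimp only at h1 h2 ⊢
    linarith
  rintro - ⟨x, y, a⟩ ⟨hx, hy, ha⟩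
  dsimp only at hx hy ha ⊢
  have ha' := hgrid ha
  obtain ⟨s, wt, hs, hwt, hsum, hvar, hval⟩ := hd.triangulation.exists_barycentric hx
  -- The minimizer depends on the vertex. This is harmless: `value_le_step` holds for every
  -- admissible `b`, and the inequalities are averaged afterwards.
  have hb : ∀ i : E ν, ∃ b, i ∈ s → b ∈ controlGridFrom h a ∧ timeStep g f lam h b w i a = w i a := by
    intro i
    by_cases hi : i ∈ s
    · obtain ⟨b, hb, hb'⟩ := (hw.2.nodal i (hs i hi) a ha).1
      exact ⟨b, fun _ => ⟨hb, hb'⟩⟩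
    · exact ⟨0, fun h => absurd h hi⟩
  choose b hb using hb
  obtain ⟨y₁, hy₁⟩ := hviable y hy _ ((isControl_const ha').mono ha'.1)
  have hmem : ∀ i ∈ s, i ∈ K.space := fun i hi =>
    Geometry.SimplicialComplex.vertices_subset_space (hs i hi)
  refine ⟨s, wt, fun i => ‖i - y‖, fun i => (i + h • g i a, y₁ h, b i), fun i hi =>
    ⟨hd.stable i (hmem i hi) a ha, hy₁.mem h hh.le, (hb i hi).1.1⟩, hwt, hsum,
    fun i _ => norm_nonneg _, hvar y, fun i hi => ?_, ?_⟩
  · have h1 := norm_euler_sub_le hg (hsub (hmem i hi)) hy ha' hh.le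
    have h2 := hy₁.norm_sub_euler_le hg hLg.le hMg.le hΩ hy (hy₁.isPath (isControl_const ha')) ha'
      hh.le (δ := 0) (fun s _ _ => by simp)
    have h3 := norm_sub_le_norm_sub_add_norm_sub (i + h • g i a) (y + h • g y a) (y₁ h)
    rw [norm_sub_rev (y + h • g y a)] at h3
    have h4 : h * (Lg * (Mg * h + 0)) ≤
        (Lg * (Mg + 1) + Lf * (Mg + 1) + 2 * Mf * lam) * h * (h + 0) := by
      have : 0 ≤ (Lg + Lf * (Mg + 1) + 2 * Mf * lam) * h * h := by positivity
      linarith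
    linarith
  · rw [hval h w hw.1 a ha]
    have h1 : value Ω g f lam y a = ∑ i ∈ s, wt i * value Ω g f lam y a := by
      rw [← Finset.sum_mul, hsum, one_mul]
    rw [h1, ← Finset.sum_sub_distrib]
    refine Finset.sum_le_sum fun i hi => ?_
    rw [← mul_sub]
    refine mul_le_mul_of_nonneg_left ?_ (hwt i hi)
    obtain ⟨hbi, hbi'⟩ := hb i hi
    have h2 := value_le_step hf hLf.le hMf.le hg hLg.le hMg.le hΩ hlam hviable hy ha'
      (hgrid hbi.1) hbi.2.1 hh.le hd.step_small hy₁
    have h3 := (abs_le.1 (abs_sub_le_min hf (hsub (hmem i hi)) hy ha')).1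
    have h4 : h * (f y a - f i a) ≤ h * min (2 * Mf) (Lf * ‖i - y‖) := by
      gcongr; linarith
    have h5 : h * (Lf * (Mg * h) + 2 * Mf * lam * h) ≤
        (Lg * (Mg + 1) + Lf * (Mg + 1) + 2 * Mf * lam) * h * (h + 0) := by
      have : 0 ≤ (Lg * (Mg + 1) + Lf) * h * h := by positivity
      linarith
    rw [← hbi', timeStep]
    linarith

/-! ### Sampled controls and the reverse estimate. -/

/-- Sampling of a monotone control on the grid, with initial value `a`. -/
def sampledControl (h a : ℝ) (α : ℝ → ℝ) : ℕ → ℝ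
  | 0 => a
  | n + 1 => ⌊α ((n + 1 : ℕ) * h) / h⌋₊ * h

section Sampling

variable {a : ℝ} {α : ℝ → ℝ}

theorem sampledControl_mem (hh : 0 < h) (ha : a ∈ controlGrid h) (hα : IsControl a α) (n : ℕ) :
    sampledControl h a α n ∈ controlGrid h := by
  cases n with
  | zero => exact ha
  | succ n =>
    refine ⟨_, ?_, rfl⟩
    have h1 := hα.mem_Icc ((n + 1 : ℕ) * h) (by positivity)
    refine (Nat.floor_le (div_nonneg h1.1 hh.le)).trans ?_
    have := h1.2
    gcongr

theorem sampledControl_le (hh : 0 < h) (hα : IsControl a α) (n : ℕ) :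
    sampledControl h a α n ≤ α (n * h) := by
  cases n with
  | zero => simpa [sampledControl] using hα.le_initial
  | succ n =>
    have h1 := hα.mem_Icc ((n + 1 : ℕ) * h) (by positivity)
    have h2 := Nat.floor_le (div_nonneg h1.1 hh.le)
    rwa [le_div_iff₀ hh] at h2

theorem lt_sampledControl_succ_add (hh : 0 < h) (n : ℕ) :
    α ((n + 1 : ℕ) * h) < sampledControl h a α (n + 1) + h := by
  have h2 := Nat.lt_floor_add_one (α ((n + 1 : ℕ) * h) / h)
  rw [div_lt_iff₀ hh] at h2
  simp only [sampledControl]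
  linarith

theorem le_floor_mul_of_mem_controlGrid (hh : 0 < h) (ha : a ∈ controlGrid h) {c : ℝ}
    (hac : a ≤ c) : a ≤ ⌊c / h⌋₊ * h := by
  obtain ⟨i, -, rfl⟩ := ha
  have : i ≤ ⌊c / h⌋₊ := Nat.le_floor (by rwa [le_div_iff₀ hh])
  gcongr

theorem sampledControl_le_succ (hh : 0 < h) (ha : a ∈ controlGrid h) (hα : IsControl a α) (n : ℕ) :
    sampledControl h a α n ≤ sampledControl h a α (n + 1) := by
  refine le_floor_mul_of_mem_controlGrid hh (sampledControl_mem hh ha hα n)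
    ((sampledControl_le hh hα n).trans (hα.monotoneOn ?_ ?_ ?_))
  · exact mem_Ici.2 (by positivity)
  · exact mem_Ici.2 (by positivity)
  · gcongr; simp

/-- By monotonicity `α` lies on this interval between the current sample and the next sample plus
the rounding error `h`. No continuity of `α` is needed, since the increments telescope. -/
theorem abs_sub_sampledControl_le (hh : 0 < h) (hα : IsControl a α) (n : ℕ) {s : ℝ} (hs : 0 ≤ s)
    (hsh : s ≤ h) : |α (s + n * h) - sampledControl h a α n| ≤
      h + (sampledControl h a α (n + 1) - sampledControl h a α n) := by
  have h0 : (0 : ℝ) ≤ n * h := by positivity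
  have h1 : α (n * h) ≤ α (s + n * h) :=
    hα.monotoneOn (mem_Ici.2 h0) (mem_Ici.2 (by linarith)) (by linarith)
  have h2 : α (s + n * h) ≤ α ((n + 1 : ℕ) * h) :=
    hα.monotoneOn (mem_Ici.2 (by linarith)) (mem_Ici.2 (by positivity)) (by push_cast; linarith)
  have h3 := sampledControl_le hh hα n
  have h4 := lt_sampledControl_succ_add (a := a) (α := α) hh n
  rw [abs_of_nonneg (by linarith)]
  linarith

end Sampling

/-- For a fixed control `α`, the discrete system follows its samples and is compared with the
cost-to-go `J n` from time `n * h`. The bound is uniform in `α`, so the infimum can be taken at the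
end. -/
theorem exists_sub_value_le (hf : IsLipschitzBounded Ω f Lf Mf) (hLf : 0 < Lf) (hMf : 0 < Mf)
    (hg : IsLipschitzBounded Ω g Lg Mg) (hLg : 0 < Lg) (hMg : 0 < Mg) (hΩ : IsOpen Ω)
    (hlam : 0 < lam)
    (hviable : ∀ x ∈ Ω, ∀ α : ℝ → ℝ, IsControl 0 α → ∃ y : ℝ → E ν, IsTrajectory Ω g x α y)
    (hγ : IsHolderExponent lam Lg γ) :
    ∃ M : ℝ, 0 < M ∧ ∀ (K : Geometry.SimplicialComplex ℝ (E ν)) (k h : ℝ),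
      IsDiscretization Ω g lam K k h → ∀ w, IsFullyDiscreteSolution g f lam K h w →
      ∀ x ∈ K.space, ∀ a ∈ controlGrid h, w x a - value Ω g f lam x a ≤ M * (h + k / √h) ^ γ := by
  -- `2 * Mf` bounds differences of `f`; in `κ`, the summands `+ 1` absorb the control oscillation
  -- `h + δ n`.
  obtain ⟨M, hM, hbound⟩ := exists_comparison_bound (Lf := Lf) (G := 2 * Mf)
    (κ := Lg * (Mg + 1) + Lf * (Mg + 1) + 2 * Mf * lam) hγ hlam hLg hLf (by positivity)
    (by positivity)
  refine ⟨M, hM, fun K k h hd w hw x hx a ha => ?_⟩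
  have hh := hd.step_pos
  have hsub := hd.triangulation.space_subset
  have hgrid := controlGrid_subset_Icc hh
  rw [sub_le_comm]
  refine le_value hviable (hsub hx) (hgrid ha) fun α y hα hy => ?_
  rw [sub_le_comm]
  set c := sampledControl h a α with hc
  have hcmem : ∀ n, c n ∈ controlGrid h := sampledControl_mem hh ha hα
  have hcle : ∀ n, c n ≤ c (n + 1) := sampledControl_le_succ hh ha hα
  have hnh : ∀ n : ℕ, (0 : ℝ) ≤ n * h := fun n => by positivity
  have hp := hy.isPath hα
  set J : ℕ → ℝ := fun n => cost f lam (fun s => α (s + n * h)) fun s => y (s + n * h) with hJ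
  have hJ0 : J 0 = cost f lam α y := by simp [hJ]
  have hJsucc : ∀ n : ℕ, (cost f lam (fun s => α (s + h + n * h)) fun s => y (s + h + n * h)) =
      J (n + 1) := by
    intro n
    have : ∀ s, s + h + n * h = s + (n + 1 : ℕ) * h := fun s => by push_cast; ring
    simp only [hJ, this]
  obtain ⟨C, hC⟩ := hw.1.exists_abs_le hd.triangulation.finite
  have hkey := hbound h k hh hd.step_le_one hd.step_small hd.mesh_pos (E ν) (E ν) K.space
    (fun n x => w x (c n) - J n) (fun n x => ‖x - y (n * h)‖) (fun n => c (n + 1) - c n)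
    (fun n => sub_nonneg.2 (hcle n)) (fun N => ?_) ⟨C + Mf / lam, ?_⟩
    (fun _ _ _ => norm_nonneg _) ?_ x hx (by simp [hy.initial])
  · simp only [hJ0] at hkey
    exact hkey
  · rw [Finset.sum_range_sub]
    have h1 := (hgrid (hcmem N)).2
    have h2 := (hgrid (hcmem 0)).1
    linarith
  · intro n x hx
    have h1 := abs_le.1 (hC x hx _ (hcmem n))
    have h2 := abs_le.1 (abs_cost_le hf hlam (hp.shift (hnh n)))
    simp only [hJ]
    linarith
  intro n x hx
  have ha' := hgrid (hcmem n)
  have hyn : y (n * h) ∈ Ω := hp.mem _ (hnh n)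
  obtain ⟨s, wt, hs, hwt, hsum, hvar, hval⟩ := hd.triangulation.exists_barycentric hx
  have hmem : ∀ i ∈ s, i ∈ K.space := fun i hi =>
    Geometry.SimplicialComplex.vertices_subset_space (hs i hi)
  have hδ : ∀ s, 0 ≤ s → s ≤ h → |α (s + n * h) - c n| ≤ h + (c (n + 1) - c n) :=
    fun s h1 h2 => abs_sub_sampledControl_le hh hα n h1 h2
  have hyn' := hy.shift hg hLg.le hΩ hα (hnh n)
  have hδ0 : 0 ≤ c (n + 1) - c n := sub_nonneg.2 (hcle n)
  refine ⟨s, wt, fun i => ‖i - y (n * h)‖, fun i => i + h • g i (c n), fun i hi =>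
    hd.stable i (hmem i hi) _ (hcmem n), hwt, hsum, fun i _ => norm_nonneg _, hvar _,
    fun i hi => ?_, ?_⟩
  · have h1 := norm_euler_sub_le hg (hsub (hmem i hi)) hyn ha' hh.le
    have h2 := hyn'.norm_sub_euler_le hg hLg.le hMg.le hΩ hyn (hp.shift (hnh n)) ha' hh.le hδ
    have h3 := norm_sub_le_norm_sub_add_norm_sub (i + h • g i (c n))
      (y (n * h) + h • g (y (n * h)) (c n)) (y (h + n * h))
    rw [norm_sub_rev (y (n * h) + _)] at h3
    have h4 : h * (Lg * (Mg * h + (h + (c (n + 1) - c n)))) ≤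
        (Lg * (Mg + 1) + Lf * (Mg + 1) + 2 * Mf * lam) * h * (h + (c (n + 1) - c n)) := by
      have e1 : 0 ≤ (Lf * (Mg + 1) + 2 * Mf * lam) * h * (h + (c (n + 1) - c n)) := by positivity
      have e2 : 0 ≤ Lg * Mg * h * (c (n + 1) - c n) := by positivity
      linarith
    have h5 : ((n + 1 : ℕ) : ℝ) * h = h + n * h := by push_cast; ring
    rw [h5]
    linarith
  · rw [hval h w hw.1 _ (hcmem n)]
    have h1 : J n = ∑ i ∈ s, wt i * J n := by rw [← Finset.sum_mul, hsum, one_mul]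
    rw [h1, ← Finset.sum_sub_distrib]
    refine Finset.sum_le_sum fun i hi => ?_
    rw [← mul_sub]
    refine mul_le_mul_of_nonneg_left ?_ (hwt i hi)
    have h2 := (abs_le.1 (abs_cost_sub_le hf hLf.le hMf.le hg hMg.le hΩ hlam hyn (hp.shift (hnh n))
      hyn' ha' hh.le hd.step_small hδ)).1
    rw [hJsucc] at h2
    have h3 := (abs_le.1 (abs_sub_le_min hf (hsub (hmem i hi)) hyn ha')).2
    have h4 : h * (f i (c n) - f (y (n * h)) (c n)) ≤
        h * min (2 * Mf) (Lf * ‖i - y (n * h)‖) := by gcongr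
    -- The next sample is an admissible choice in the minimum because the samples do not decrease.
    have h5 : w i (c n) ≤ timeStep g f lam h (c (n + 1)) w i (c n) :=
      (hw.2.nodal i (hs i hi) _ (hcmem n)).2
        ⟨_, ⟨hcmem (n + 1), hcle n, (hgrid (hcmem (n + 1))).2⟩, rfl⟩
    have h6 : h * (Lf * (Mg * h + (h + (c (n + 1) - c n))) + 2 * Mf * lam * h) ≤
        (Lg * (Mg + 1) + Lf * (Mg + 1) + 2 * Mf * lam) * h * (h + (c (n + 1) - c n)) := by
      have e1 : 0 ≤ (Lg * (Mg + 1)) * h * (h + (c (n + 1) - c n)) := by positivity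
      have e2 : 0 ≤ (Lf * Mg + 2 * Mf * lam) * h * (c (n + 1) - c n) := by positivity
      linarith
    rw [timeStep] at h5
    have h7 : J n = cost f lam (fun s => α (s + n * h)) fun s => y (s + n * h) := rfl
    rw [← h7] at h2
    linarith

/-! ### Rates in terms of the mesh size. -/

/-- The terms `h` and `k / √h` balance at `h = k ^ (2 / 3)`: for larger `h` the first term suffices,
for smaller `h` the second. -/
theorem rpow_two_thirds_le {k h : ℝ} (hk : 0 < k) (hh : 0 < h) :
    k ^ (2 / 3 : ℝ) ≤ h + k / √h := by
  rcases le_total (k ^ (2 / 3 : ℝ)) h with h1 | h1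
  · have : 0 ≤ k / √h := by positivity
    linarith
  · have h2 : √h ≤ k ^ (1 / 3 : ℝ) := by
      refine Real.sqrt_le_iff.2 ⟨by positivity, ?_⟩
      rw [← Real.rpow_natCast, ← Real.rpow_mul hk.le]
      norm_num
      exact h1
    have h3 : k ^ (2 / 3 : ℝ) = k / k ^ (1 / 3 : ℝ) := by
      rw [eq_div_iff (by positivity), ← Real.rpow_add hk]
      norm_num
    have h4 : k / k ^ (1 / 3 : ℝ) ≤ k / √h := by gcongr
    linarith

theorem add_div_sqrt_le_rpow_two_thirds {c₁ c₂ k h : ℝ} (hc₁ : 0 < c₁) (hk : 0 < k)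
    (h1 : c₁ * k ^ (2 / 3 : ℝ) ≤ h) (h2 : h ≤ c₂ * k ^ (2 / 3 : ℝ)) :
    h + k / √h ≤ (c₂ + 1 / √c₁) * k ^ (2 / 3 : ℝ) := by
  have h3 : √c₁ * k ^ (1 / 3 : ℝ) ≤ √h := by
    refine Real.le_sqrt_of_sq_le ?_
    rw [mul_pow, Real.sq_sqrt hc₁.le, ← Real.rpow_natCast, ← Real.rpow_mul hk.le]
    norm_num
    exact h1
  have h4 : k / √h ≤ k / (√c₁ * k ^ (1 / 3 : ℝ)) := by gcongr
  have h5 : k ^ (2 / 3 : ℝ) = k / k ^ (1 / 3 : ℝ) := by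
    rw [eq_div_iff (by positivity), ← Real.rpow_add hk]
    norm_num
  have h6 : k / (√c₁ * k ^ (1 / 3 : ℝ)) = 1 / √c₁ * k ^ (2 / 3 : ℝ) := by
    rw [h5]; field_simp
  linarith

/-- For `h` of order `k` the term `k / √h` is of order `√k`, and `h ≤ 1` gives `h ≤ √h`, so the
other term is no larger in order. -/
theorem add_div_sqrt_le_sqrt {c₁ c₂ k h : ℝ} (hc₁ : 0 < c₁) (hk : 0 < k) (hh : 0 < h)
    (hh1 : h ≤ 1) (h1 : c₁ * k ≤ h) (h2 : h ≤ c₂ * k) :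
    h + k / √h ≤ (√c₂ + 1 / √c₁) * k ^ (1 / 2 : ℝ) := by
  have hc₂ : 0 ≤ c₂ := by
    by_contra hcon
    have := mul_neg_of_neg_of_pos (not_le.1 hcon) hk
    linarith
  rw [← Real.sqrt_eq_rpow]
  have h3 : √c₁ * √k ≤ √h := by
    rw [← Real.sqrt_mul hc₁.le]; exact Real.sqrt_le_sqrt h1
  have h4 : k / √h ≤ k / (√c₁ * √k) := by gcongr
  have h5 : k / (√c₁ * √k) = 1 / √c₁ * √k := by
    have : √k * √k = k := Real.mul_self_sqrt hk.le
    field_simp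
    linarith
  have h6 : h ≤ √c₂ * √k := by
    have e1 : √h ≤ √c₂ * √k := by
      rw [← Real.sqrt_mul hc₂]; exact Real.sqrt_le_sqrt h2
    have e2 : √h * √h = h := Real.mul_self_sqrt hh.le
    have e3 : √h ≤ 1 := Real.sqrt_le_one.2 hh1
    nlinarith [Real.sqrt_nonneg h]
  linarith

theorem rpow_le_of_le_mul_rpow {X c k s γ : ℝ} (hX : 0 ≤ X) (hc : 0 ≤ c) (hk : 0 ≤ k)
    (hγ : 0 ≤ γ) (h : X ≤ c * k ^ s) : X ^ γ ≤ c ^ γ * k ^ (s * γ) := by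
  rw [Real.rpow_mul hk, ← Real.mul_rpow hc (by positivity)]
  exact Real.rpow_le_rpow hX h hγ

end MonotoneControl

end

theorem mainTheorem3 {ν : ℕ} (Ω : Set (MonotoneControl.E ν)) (hΩ : IsOpen Ω)
    (g : MonotoneControl.E ν → ℝ → MonotoneControl.E ν)
    (f : MonotoneControl.E ν → ℝ → ℝ)
    (lam Lg Mg Lf Mf : ℝ) (hlam : 0 < lam)
    (hLg : 0 < Lg) (hMg : 0 < Mg) (hLf : 0 < Lf) (hMf : 0 < Mf)
    (hg_lip : ∀ x ∈ Ω, ∀ x' ∈ Ω, ∀ a ∈ Set.Icc (0 : ℝ) 1, ∀ a' ∈ Set.Icc (0 : ℝ) 1,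
      ‖g x a - g x' a'‖ ≤ Lg * (‖x - x'‖ + |a - a'|))
    (hg_bdd : ∀ x ∈ Ω, ∀ a ∈ Set.Icc (0 : ℝ) 1, ‖g x a‖ ≤ Mg)
    (hf_lip : ∀ x ∈ Ω, ∀ x' ∈ Ω, ∀ a ∈ Set.Icc (0 : ℝ) 1, ∀ a' ∈ Set.Icc (0 : ℝ) 1,
      |f x a - f x' a'| ≤ Lf * (‖x - x'‖ + |a - a'|))
    (hf_bdd : ∀ x ∈ Ω, ∀ a ∈ Set.Icc (0 : ℝ) 1, |f x a| ≤ Mf)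
    -- the evolution stays in `Ω`, whatever control is selected
    (hviable : ∀ x ∈ Ω, ∀ α : ℝ → ℝ, MonotoneControl.IsControl 0 α →
      ∃ y : ℝ → MonotoneControl.E ν, MonotoneControl.IsTrajectory Ω g x α y)
    (γ : ℝ) (hγ : MonotoneControl.IsHolderExponent lam Lg γ) :
    -- the fully discrete solution exists and is unique on `Ω_k × I_h`
    (∀ (K : Geometry.SimplicialComplex ℝ (MonotoneControl.E ν)) (k h : ℝ),
      MonotoneControl.IsDiscretization Ω g lam K k h →
      (∃ w, MonotoneControl.IsFullyDiscreteSolution g f lam K h w) ∧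
      ∀ w w', MonotoneControl.IsFullyDiscreteSolution g f lam K h w →
        MonotoneControl.IsFullyDiscreteSolution g f lam K h w' →
        ∀ x ∈ K.space, ∀ a ∈ MonotoneControl.controlGrid h, w x a = w' x a) ∧
    -- the general estimate
    (∃ M : ℝ, 0 < M ∧
      ∀ (K : Geometry.SimplicialComplex ℝ (MonotoneControl.E ν)) (k h : ℝ),
      MonotoneControl.IsDiscretization Ω g lam K k h →
      ∀ w, MonotoneControl.IsFullyDiscreteSolution g f lam K h w →
      ∀ x ∈ K.space, ∀ a ∈ MonotoneControl.controlGrid h,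
        |MonotoneControl.value Ω g f lam x a - w x a| ≤ M * (h + k / √h) ^ γ) ∧
    -- `h` of order `k ^ (2/3)`
    (∀ c₁ c₂ : ℝ, 0 < c₁ → 0 < c₂ → ∃ C : ℝ, 0 < C ∧
      ∀ (K : Geometry.SimplicialComplex ℝ (MonotoneControl.E ν)) (k h : ℝ),
      MonotoneControl.IsDiscretization Ω g lam K k h →
      c₁ * k ^ (2 / 3 : ℝ) ≤ h → h ≤ c₂ * k ^ (2 / 3 : ℝ) →
      ∀ w, MonotoneControl.IsFullyDiscreteSolution g f lam K h w →
      ∀ x ∈ K.space, ∀ a ∈ MonotoneControl.controlGrid h,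
        |MonotoneControl.value Ω g f lam x a - w x a| ≤ C * k ^ ((2 / 3 : ℝ) * γ)) ∧
    -- `k ^ (2γ/3)` is the best rate that the general estimate yields for any choice of `h`,
    -- and it is attained by `h` of order `k ^ (2/3)`
    (∀ k h : ℝ, 0 < k → 0 < h → k ^ ((2 / 3 : ℝ) * γ) ≤ (h + k / √h) ^ γ) ∧
    (∀ c₁ c₂ : ℝ, 0 < c₁ → 0 < c₂ → ∃ C : ℝ, 0 < C ∧ ∀ k h : ℝ, 0 < k → 0 < h →
      c₁ * k ^ (2 / 3 : ℝ) ≤ h → h ≤ c₂ * k ^ (2 / 3 : ℝ) →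
      (h + k / √h) ^ γ ≤ C * k ^ ((2 / 3 : ℝ) * γ)) ∧
    -- `h` of order `k`
    (∀ c₁ c₂ : ℝ, 0 < c₁ → 0 < c₂ → ∃ C : ℝ, 0 < C ∧
      ∀ (K : Geometry.SimplicialComplex ℝ (MonotoneControl.E ν)) (k h : ℝ),
      MonotoneControl.IsDiscretization Ω g lam K k h →
      c₁ * k ≤ h → h ≤ c₂ * k →
      ∀ w, MonotoneControl.IsFullyDiscreteSolution g f lam K h w →
      ∀ x ∈ K.space, ∀ a ∈ MonotoneControl.controlGrid h,
        |MonotoneControl.value Ω g f lam x a - w x a| ≤ C * k ^ (γ / 2)) := by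
  have hgb : MonotoneControl.IsLipschitzBounded Ω g Lg Mg := ⟨hg_lip, hg_bdd⟩
  have hfb : MonotoneControl.IsLipschitzBounded Ω f Lf Mf := ⟨hf_lip, hf_bdd⟩
  have hγ0 : 0 < γ := hγ.pos hlam hLg
  obtain ⟨M₁, hM₁, h₁⟩ := MonotoneControl.exists_value_sub_le hfb hLf hMf hgb hLg hMg hΩ hlam hviable hγ
  obtain ⟨M₂, -, h₂⟩ := MonotoneControl.exists_sub_value_le hfb hLf hMf hgb hLg hMg hΩ hlam hviable hγ
  have hM : 0 < max M₁ M₂ := lt_max_of_lt_left hM₁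
  have hmain : ∀ (K : Geometry.SimplicialComplex ℝ (MonotoneControl.E ν)) (k h : ℝ),
      MonotoneControl.IsDiscretization Ω g lam K k h → ∀ w, MonotoneControl.IsFullyDiscreteSolution g f lam K h w →
      ∀ x ∈ K.space, ∀ a ∈ MonotoneControl.controlGrid h,
        |MonotoneControl.value Ω g f lam x a - w x a| ≤ max M₁ M₂ * (h + k / √h) ^ γ := by
    intro K k h hd w hw x hx a ha
    have hX : 0 ≤ (h + k / √h) ^ γ := by
      have := hd.step_pos
      have := hd.mesh_pos
      positivity
    rw [abs_le, neg_le, neg_sub]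
    exact ⟨(h₂ K k h hd w hw x hx a ha).trans
        (mul_le_mul_of_nonneg_right (le_max_right _ _) hX),
      (h₁ K k h hd w hw x hx a ha).trans (mul_le_mul_of_nonneg_right (le_max_left _ _) hX)⟩
  have hrate : ∀ c₁ c₂ : ℝ, 0 < c₁ → 0 < c₂ → ∀ k h : ℝ, 0 < k → 0 < h →
      c₁ * k ^ (2 / 3 : ℝ) ≤ h → h ≤ c₂ * k ^ (2 / 3 : ℝ) →
      (h + k / √h) ^ γ ≤ (c₂ + 1 / √c₁) ^ γ * k ^ ((2 / 3 : ℝ) * γ) :=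
    fun c₁ c₂ hc₁ hc₂ k h hk hh h1 h2 =>
      MonotoneControl.rpow_le_of_le_mul_rpow (by positivity) (by positivity) hk.le hγ0.le
        (MonotoneControl.add_div_sqrt_le_rpow_two_thirds hc₁ hk h1 h2)
  refine ⟨fun K k h hd => ⟨MonotoneControl.exists_isFullyDiscreteSolution hlam hd, fun w w' hw hw' x hx a ha =>
      hw.eq_of_eq hlam hd hw' hx ha⟩, ⟨_, hM, hmain⟩, fun c₁ c₂ hc₁ hc₂ => ?_, fun k h hk hh => ?_,
    fun c₁ c₂ hc₁ hc₂ => ⟨_, by positivity, hrate c₁ c₂ hc₁ hc₂⟩, fun c₁ c₂ hc₁ hc₂ => ?_⟩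
  · refine ⟨max M₁ M₂ * (c₂ + 1 / √c₁) ^ γ, by positivity,
      fun K k h hd h1 h2 w hw x hx a ha => (hmain K k h hd w hw x hx a ha).trans ?_⟩
    rw [mul_assoc]
    exact mul_le_mul_of_nonneg_left (hrate c₁ c₂ hc₁ hc₂ k h hd.mesh_pos hd.step_pos h1 h2) hM.le
  · rw [Real.rpow_mul hk.le]
    exact Real.rpow_le_rpow (by positivity) (MonotoneControl.rpow_two_thirds_le hk hh) hγ0.le
  · refine ⟨max M₁ M₂ * (√c₂ + 1 / √c₁) ^ γ, by positivity,
      fun K k h hd h1 h2 w hw x hx a ha => (hmain K k h hd w hw x hx a ha).trans ?_⟩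
    have hk := hd.mesh_pos
    have hh := hd.step_pos
    rw [mul_assoc, show γ / 2 = (1 / 2 : ℝ) * γ by ring]
    exact mul_le_mul_of_nonneg_left (MonotoneControl.rpow_le_of_le_mul_rpow (by positivity) (by positivity) hk.le
      hγ0.le (MonotoneControl.add_div_sqrt_le_sqrt hc₁ hk hh hd.step_le_one h1 h2)) hM.le
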